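/- **Theorem ($H_{GF}$ is a Hopf algebra).** *Graphs.* A Feynman graph $G$ is a finite set of half-edges with a partition into vertices and a partition into parts of size $2$ (the internal edges) and size $1$ (the external edges, or legs). Multiple edges and self-loops are allowed. Its loop number is $|G|=e_G-v_G+h_0(G)$, where $e_G,v_G,h_0(G)$ are the numbers of internal edges, vertices and connected components. Fix an integer $k\ge 0$ and consider only graphs in which every vertex has at least $k$ half-edges (the usual convention for Feynman graphs is $k=3$; for $k\le 1$ this is no condition). A core graph is a graph that is bridgeless and each of whose connected components has at least one loop; it may be disconnected or empty. A spanning forest $F$ of $G$ is a set of internal edges without cycles, together with all vertices of $G$. A set $X$ of internal edges defines a subgraph $g$, whose vertices are the vertices of $G$ met by $X$, each with all its half-edges (half-edges not in $X$ become legs of $g$), and a quotient $G/g$, in which the edges of $X$ are contracted. *The algebra.* Let $H_{GF}$ be the $\mathbb Q$-vector space with basis the isomorphism classes of pairs $(G,F)$, where $G$ is a core graph and $F$ a spanning forest of $G$. Its product is the bilinear extension of disjoint union, $(G_1,F_1)(G_2,F_2)=(G_1\,\dot\cup\,G_2,F_1\,\dot\cup\,F_2)$, with unit the empty pair $\mathbb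 I$. This is a commutative $\mathbb Q$-algebra, generated by the pairs with $G$ connected. *Claim.* $H_{GF}$ carries a Hopf algebra structure over $\mathbb Q$ (coassociative coproduct and counit that are algebra maps, and an antipode) such that: 1. for every pair $(G,F)$ with $G$ connected and non-empty, $$\Delta(G,F)=(G,F)\otimes\mathbb I+\mathbb I\otimes(G,F)+\sum_{g}(g,F\cap g)\otimes(G/g,\;F-(F\cap g)),$$ where $g$ runs over the core subgraphs of $G$ given by edge sets, $g\ne\emptyset$ and $g\neq G$, such that $G/g$ again has all vertices of valence at least $k$, $F-(F\cap g)$ is a spanning forest of $G/g$, and $(G,F)$ and $(G/g,F-(F\cap g))$ induce the same partition of the legs. Here a spanning forest induces the partition that has one part for each of its trees, consisting of the legs at this tree; parts may be empty and are counted with multiplicity. That is, two legs lie in the same tree of $F$ if and only if they lie in the same tree of $F-(F\cap g)$, and both forests have the same number of trees. If every tree of $F$ carries a leg, or $F$ is a spanning tree, the condition on the number of trees follows from the others, so that it may be omitted. Since $\Delta$ is an algebra map, this determines $\Delta$; 2. the counit is $1$ on the empty pair and $0$ on every non-empty pair; 3. with $H_{GF}^{(j)}$ the span of the pairs with $|G|=j$,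 one has $H_{GF}=\bigoplus_{j\ge0}H_{GF}^{(j)}$ as a graded algebra, $H_{GF}^{(0)}=\mathbb Q\,\mathbb I$, and $\Delta\bigl(H_{GF}^{(n)}\bigr)\subseteq\sum_{i+j=n}H_{GF}^{(i)}\otimes H_{GF}^{(j)}$. -/

import Mathlib

open scoped TensorProduct

/-- A Feynman graph: a finite set `H` of half-edges with a partition of `H` into vertices
(the classes of `vert`) and a partition of `H` into parts of cardinality at most two
(the sets `{h, flip h}`, for an involution `flip`). The parts of cardinality two are the internal
edges, the fixed points of `flip` are the external edges (legs). Multiple edges and self-loops are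
allowed. -/
structure FeynmanGraph where
  H : Type
  finite : Finite H
  vert : Setoid H
  flip : H → H
  flip_flip : ∀ h, flip (flip h) = h

namespace FeynmanGraph

/-- The half-edges that belong to internal edges. -/
def internal (G : FeynmanGraph) : Set G.H := {h | G.flip h ≠ h}

/-- A set of internal edges, given as the set of half-edges of these edges. -/
def IsEdgeSet (G : FeynmanGraph) (X : Set G.H) : Prop :=
  ∀ h ∈ X, G.flip h ∈ X ∧ G.flip h ≠ h

/-- The partition of the half-edges by the connected components of the graph that has all vertices
of `G` and only those internal edges of `G` that lie in `X`. -/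
def conn (G : FeynmanGraph) (X : Set G.H) : Setoid G.H :=
  Relation.EqvGen.setoid fun a b => G.vert a b ∨ (a ∈ X ∧ b = G.flip a)

/-- The number of connected components of the graph with all vertices of `G` and the edges `X`. -/
noncomputable def numComponents (G : FeynmanGraph) (X : Set G.H) : ℕ :=
  Nat.card (Quotient (G.conn X))

/-- The number of internal edges. -/
noncomputable def numEdges (G : FeynmanGraph) : ℕ := Nat.card G.internal / 2

/-- The number of vertices. -/
noncomputable def numVertices (G : FeynmanGraph) : ℕ := Nat.card (Quotient G.vert)

/-- The loop number `|G| = e_G - v_G + h_0(G)`, written so that the subtraction of natural numbers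
never truncates. -/
noncomputable def loopNumber (G : FeynmanGraph) : ℕ :=
  (G.numEdges + G.numComponents G.internal) - G.numVertices

/-- The edges in `X` form no cycle: the two ends of an edge of `X` are not joined by the other
edges of `X`. -/
def IsAcyclic (G : FeynmanGraph) (X : Set G.H) : Prop :=
  ∀ h ∈ X, ¬ G.conn (X \ {h, G.flip h}) h (G.flip h)

/-- No internal edge is a bridge: after the removal of an internal edge its two ends are still
joined by the other internal edges. -/
def IsBridgeless (G : FeynmanGraph) : Prop :=
  ∀ h ∈ G.internal, G.conn (G.internal \ {h, G.flip h}) h (G.flip h)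

/-- The graph is connected and not empty. -/
def IsConnected (G : FeynmanGraph) : Prop :=
  Nonempty G.H ∧ ∀ a b, G.conn G.internal a b

open Classical in
/-- The subgraph with set of internal edges `X`. Its vertices are the vertices of `G` that are met
by `X`, each with all its half-edges; the half-edges that are not in `X` become legs. -/
noncomputable def sub (G : FeynmanGraph) (X : Set G.H) (hX : G.IsEdgeSet X) : FeynmanGraph where
  H := {h : G.H // ∃ x ∈ X, G.vert h x}
  finite := by
    have := G.finite
    infer_instance
  vert := G.vert.comap Subtype.val
  flip h := if hh : h.1 ∈ X then ⟨G.flip h.1, G.flip h.1, (hX h.1 hh).1, G.vert.refl _⟩ else h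
  flip_flip h := by
    by_cases hh : h.1 ∈ X
    · have h2 : G.flip h.1 ∈ X := (hX h.1 hh).1
      simp [hh, h2, G.flip_flip]
    · simp [hh]

/-- The graph `G / X`: the edges of `X` are contracted. Their half-edges are deleted, and vertices
that are joined by edges of `X` are merged. -/
def contract (G : FeynmanGraph) (X : Set G.H) (hX : G.IsEdgeSet X) : FeynmanGraph where
  H := {h : G.H // h ∉ X}
  finite := by
    have := G.finite
    infer_instance
  vert := (G.conn X).comap Subtype.val
  flip h := ⟨G.flip h.1, fun h2 => h.2 (by simpa [G.flip_flip] using (hX _ h2).1)⟩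
  flip_flip h := by simp [G.flip_flip]

/-- The empty graph. -/
def empty : FeynmanGraph where
  H := Empty
  finite := inferInstance
  vert := ⊥
  flip := id
  flip_flip _ := rfl

/-- The disjoint union of two graphs. -/
def disjUnion (G G' : FeynmanGraph) : FeynmanGraph where
  H := G.H ⊕ G'.H
  finite := by
    have := G.finite
    have := G'.finite
    infer_instance
  vert :=
    { r := Sum.LiftRel G.vert G'.vert
      iseqv :=
        { refl := by rintro (a | a) <;> simp
          symm := by
            rintro (a | a) (b | b) h <;> simp at h ⊢
            · exact G.vert.symm h
            · exact G'.vert.symm h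
          trans := by
            rintro (a | a) (b | b) (c | c) h h' <;> simp at h h' ⊢
            · exact G.vert.trans h h'
            · exact G'.vert.trans h h' } }
  flip := Sum.map G.flip G'.flip
  flip_flip := by rintro (a | a) <;> simp [G.flip_flip, G'.flip_flip]

/-- The union of two sets of half-edges in the disjoint union of two graphs. -/
def sumSet {G G' : FeynmanGraph} (X : Set G.H) (X' : Set G'.H) : Set (G.disjUnion G').H :=
  {h | Sum.elim (· ∈ X) (· ∈ X') h}

end FeynmanGraph

/-- A Feynman graph with a distinguished set `F` of half-edges (meant to be those of the edges of
a spanning forest). -/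
structure MarkedGraph extends FeynmanGraph where
  F : Set H

namespace MarkedGraph

/-- `(G, F)` is a pair of a core graph and a spanning forest: `G` is bridgeless, every component
of `G` has at least one loop (no vertex is without internal edges), every vertex has at least `k`
half-edges, and `F` is a set of internal edges without cycles (together with all vertices of `G`
these edges are a spanning forest). The graph need not be connected and may be empty. -/
structure IsCorePair (k : ℕ) (P : MarkedGraph) : Prop where
  bridgeless : P.IsBridgeless
  no_isolated : ∀ h, ∃ x ∈ P.internal, P.vert h x
  valence : ∀ h, k ≤ Nat.card {h' // P.vert h h'}
  edges : P.IsEdgeSet P.F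
  acyclic : P.IsAcyclic P.F

/-- The pair `(g, F ∩ g)` for the subgraph `g` with set of edges `X`. -/
noncomputable def sub (P : MarkedGraph) (X : Set P.H) (hX : P.IsEdgeSet X) : MarkedGraph where
  toFeynmanGraph := P.toFeynmanGraph.sub X hX
  F := {h | h.1 ∈ P.F ∩ X}

/-- The pair `(G / g, F - (F ∩ g))` for the subgraph `g` with set of edges `X`. -/
def contract (P : MarkedGraph) (X : Set P.H) (hX : P.IsEdgeSet X) : MarkedGraph where
  toFeynmanGraph := P.toFeynmanGraph.contract X hX
  F := {h | h.1 ∈ P.F}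

/-- The empty pair. -/
def empty : MarkedGraph where
  toFeynmanGraph := FeynmanGraph.empty
  F := ∅

/-- The disjoint union of two pairs. -/
def disjUnion (P Q : MarkedGraph) : MarkedGraph where
  toFeynmanGraph := P.toFeynmanGraph.disjUnion Q.toFeynmanGraph
  F := FeynmanGraph.sumSet P.F Q.F

/-- Isomorphisms of pairs. -/
structure Iso (P Q : MarkedGraph) where
  toEquiv : P.H ≃ Q.H
  vert_iff : ∀ a b, Q.vert (toEquiv a) (toEquiv b) ↔ P.vert a b
  map_flip : ∀ a, toEquiv (P.flip a) = Q.flip (toEquiv a)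
  mem_F_iff : ∀ a, toEquiv a ∈ Q.F ↔ a ∈ P.F

/-- The pairs `(G, F)` and `(G / g, F - (F ∩ g))` induce the same partition of the external edges:
two legs lie in the same tree of `F` if and only if they lie in the same tree of
`F - (F ∩ g)` in `G / g`. -/
def SameLegPartition (P : MarkedGraph) (X : Set P.H) (hX : P.IsEdgeSet X) : Prop :=
  ∀ a b : (P.contract X hX).H, P.flip a.1 = a.1 → P.flip b.1 = b.1 →
    (P.conn P.F a.1 b.1 ↔ (P.contract X hX).conn (P.contract X hX).F a b)

/-- The spanning forest `F` of `G` and the spanning forest `F - (F ∩ g)` of `G / g` have the same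
number of trees. -/
def SameTreeNumber (P : MarkedGraph) (X : Set P.H) (hX : P.IsEdgeSet X) : Prop :=
  P.numComponents P.F = (P.contract X hX).numComponents (P.contract X hX).F

/-- Every tree of the forest `F` carries at least one leg. -/
def EveryTreeHasLeg (P : MarkedGraph) : Prop :=
  ∀ h, ∃ l, P.flip l = l ∧ P.conn P.F h l

/-- The forest `F` is a spanning tree: it joins any two vertices of `G`. -/
def IsTree (P : MarkedGraph) : Prop := ∀ a b, P.conn P.F a b

end MarkedGraph

namespace FeynmanGraph

/-- A map compatible with the generating relations respects connectivity. -/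
theorem conn_map {G G' : FeynmanGraph} {X : Set G.H} {X' : Set G'.H} (f : G.H → G'.H)
    (hv : ∀ a b, G.vert a b → G'.vert (f a) (f b))
    (hf : ∀ a ∈ X, f a ∈ X' ∧ f (G.flip a) = G'.flip (f a)) {a b : G.H}
    (h : G.conn X a b) : G'.conn X' (f a) (f b) := by
  induction h with
  | rel x y h =>
    rcases h with h | ⟨h, rfl⟩
    · exact Relation.EqvGen.rel _ _ (Or.inl (hv _ _ h))
    · exact Relation.EqvGen.rel _ _ (Or.inr ⟨(hf _ h).1, (hf _ h).2⟩)
  | refl x => exact Relation.EqvGen.refl _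
  | symm x y _ ih => exact Relation.EqvGen.symm _ _ ih
  | trans x y z _ _ ih1 ih2 => exact Relation.EqvGen.trans _ _ _ ih1 ih2

/-- Connectivity in a disjoint union is componentwise. -/
theorem conn_disjUnion {G G' : FeynmanGraph} {X : Set G.H} {X' : Set G'.H}
    {a b : (G.disjUnion G').H} (h : (G.disjUnion G').conn (sumSet X X') a b) :
    Sum.LiftRel (G.conn X) (G'.conn X') a b := by
  induction h with
  | rel x y h =>
    rcases h with h | ⟨h, rfl⟩
    · exact Sum.LiftRel.mono (fun _ _ h => Relation.EqvGen.rel _ _ (Or.inl h))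
        (fun _ _ h => Relation.EqvGen.rel _ _ (Or.inl h)) h
    · rcases x with x | x
      · exact Sum.LiftRel.inl (Relation.EqvGen.rel _ _ (Or.inr ⟨h, rfl⟩))
      · exact Sum.LiftRel.inr (Relation.EqvGen.rel _ _ (Or.inr ⟨h, rfl⟩))
  | refl x => rcases x with x | x <;> constructor <;> exact Setoid.refl' _ _
  | symm x y _ ih =>
    rcases ih with ih | ih <;> constructor <;> exact Setoid.symm' _ ih
  | trans x y z _ _ ih1 ih2 =>
    cases ih1 <;> cases ih2 <;> constructor <;> exact Setoid.trans' _ ‹_› ‹_›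

theorem isBridgeless_disjUnion {G G' : FeynmanGraph} (h : G.IsBridgeless) (h' : G'.IsBridgeless) :
    (G.disjUnion G').IsBridgeless := by
  rintro (a | a) ha
  · have ha' : a ∈ G.internal := fun e => ha (congrArg Sum.inl e)
    refine conn_map (G' := G.disjUnion G') Sum.inl (fun _ _ h => Sum.LiftRel.inl h) ?_ (h a ha')
    rintro b ⟨hb1, hb2⟩
    refine ⟨⟨fun e => hb1 (Sum.inl_injective e), fun e => hb2 ?_⟩, rfl⟩
    rcases e with e | e
    · exact Or.inl (Sum.inl_injective e)
    · exact Or.inr (Sum.inl_injective e)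
  · have ha' : a ∈ G'.internal := fun e => ha (congrArg Sum.inr e)
    refine conn_map (G' := G.disjUnion G') Sum.inr (fun _ _ h => Sum.LiftRel.inr h) ?_ (h' a ha')
    rintro b ⟨hb1, hb2⟩
    refine ⟨⟨fun e => hb1 (Sum.inr_injective e), fun e => hb2 ?_⟩, rfl⟩
    rcases e with e | e
    · exact Or.inl (Sum.inr_injective e)
    · exact Or.inr (Sum.inr_injective e)

theorem isAcyclic_disjUnion {G G' : FeynmanGraph} {X : Set G.H} {X' : Set G'.H}
    (h : G.IsAcyclic X) (h' : G'.IsAcyclic X') :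
    (G.disjUnion G').IsAcyclic (sumSet X X') := by
  rintro (a | a) ha hc
  · have hc' := conn_disjUnion (X := X \ {a, G.flip a}) (X' := X')
      (conn_map (G' := G.disjUnion G') id (fun _ _ h => h) (by
        rintro (b | b) ⟨hb1, hb2⟩
        · refine ⟨⟨hb1, fun e => hb2 ?_⟩, rfl⟩
          rcases e with e | e
          · exact Or.inl (congrArg Sum.inl e)
          · exact Or.inr (congrArg Sum.inl e)
        · exact ⟨hb1, rfl⟩) hc)
    cases hc' with
    | inl hc' => exact h a ha hc'
  · have hc' := conn_disjUnion (X := X) (X' := X' \ {a, G'.flip a})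
      (conn_map (G' := G.disjUnion G') id (fun _ _ h => h) (by
        rintro (b | b) ⟨hb1, hb2⟩
        · exact ⟨hb1, rfl⟩
        · refine ⟨⟨hb1, fun e => hb2 ?_⟩, rfl⟩
          rcases e with e | e
          · exact Or.inl (congrArg Sum.inr e)
          · exact Or.inr (congrArg Sum.inr e)) hc)
    cases hc' with
    | inr hc' => exact h' a ha hc'

end FeynmanGraph

namespace MarkedGraph

theorem isCorePair_empty (k : ℕ) : IsCorePair k empty where
  bridgeless := fun h => h.elim
  no_isolated := fun h => h.elim
  valence := fun h => h.elim
  edges := fun h => h.elim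
  acyclic := fun h => h.elim

theorem isCorePair_disjUnion {k : ℕ} {P Q : MarkedGraph} (hP : IsCorePair k P)
    (hQ : IsCorePair k Q) : IsCorePair k (P.disjUnion Q) where
  bridgeless := FeynmanGraph.isBridgeless_disjUnion hP.bridgeless hQ.bridgeless
  no_isolated := by
    rintro (a | a)
    · obtain ⟨x, hx, hv⟩ := hP.no_isolated a
      exact ⟨Sum.inl x, fun e => hx (Sum.inl_injective e), Sum.LiftRel.inl hv⟩
    · obtain ⟨x, hx, hv⟩ := hQ.no_isolated a
      exact ⟨Sum.inr x, fun e => hx (Sum.inr_injective e), Sum.LiftRel.inr hv⟩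
  valence := by
    have := (P.disjUnion Q).finite
    rintro (a | a)
    · exact (hP.valence a).trans (Nat.card_le_card_of_injective
        (fun h => (⟨Sum.inl h.1, Sum.LiftRel.inl h.2⟩ :
          {h' // (P.disjUnion Q).vert (Sum.inl a) h'}))
        (fun x y e => Subtype.ext (Sum.inl_injective (congrArg Subtype.val e))))
    · exact (hQ.valence a).trans (Nat.card_le_card_of_injective
        (fun h => (⟨Sum.inr h.1, Sum.LiftRel.inr h.2⟩ :
          {h' // (P.disjUnion Q).vert (Sum.inr a) h'}))
        (fun x y e => Subtype.ext (Sum.inr_injective (congrArg Subtype.val e))))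
  edges := by
    rintro (a | a) ha
    · exact ⟨(hP.edges a ha).1, fun e => (hP.edges a ha).2 (Sum.inl_injective e)⟩
    · exact ⟨(hQ.edges a ha).1, fun e => (hQ.edges a ha).2 (Sum.inr_injective e)⟩
  acyclic := FeynmanGraph.isAcyclic_disjUnion hP.acyclic hQ.acyclic

end MarkedGraph

/-- The pairs `(G, F)` of a core graph and a spanning forest, with all vertices of valence at
least `k`. -/
def CorePair (k : ℕ) : Type 1 := {P : MarkedGraph // P.IsCorePair k}

/-- Two pairs are identified if they are isomorphic. -/
instance CorePair.setoid (k : ℕ) : Setoid (CorePair k) where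
  r P Q := Nonempty (MarkedGraph.Iso P.1 Q.1)
  iseqv :=
    { refl := fun _ => ⟨⟨Equiv.refl _, fun _ _ => Iff.rfl, fun _ => rfl, fun _ => Iff.rfl⟩⟩
      symm := by
        rintro P Q ⟨e⟩
        refine ⟨⟨e.toEquiv.symm, fun a b => ?_, fun a => ?_, fun a => ?_⟩⟩
        · simp [← e.vert_iff]
        · rw [Equiv.symm_apply_eq, e.map_flip, Equiv.apply_symm_apply]
        · simp [← e.mem_F_iff]
      trans := by
        rintro P Q R ⟨e⟩ ⟨f⟩
        refine ⟨⟨e.toEquiv.trans f.toEquiv, fun a b => ?_, fun a => ?_, fun a => ?_⟩⟩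
        · simp [f.vert_iff, e.vert_iff]
        · simp [f.map_flip, e.map_flip]
        · simp [f.mem_F_iff, e.mem_F_iff] }

/-- The disjoint union of two pairs. -/
def CorePair.disjUnion {k : ℕ} (P Q : CorePair k) : CorePair k :=
  ⟨P.1.disjUnion Q.1, MarkedGraph.isCorePair_disjUnion P.2 Q.2⟩

/-- Isomorphism classes of pairs. -/
def GFClass (k : ℕ) : Type 1 := Quotient (CorePair.setoid k)

/-- Disjoint union makes the isomorphism classes of pairs a commutative monoid; its unit is the
empty pair. -/
instance GFClass.commMonoid (k : ℕ) : CommMonoid (GFClass k) where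
  mul := Quotient.map₂ CorePair.disjUnion (by
    rintro P P' ⟨e⟩ Q Q' ⟨f⟩
    refine ⟨⟨Equiv.sumCongr e.toEquiv f.toEquiv, ?_, ?_, ?_⟩⟩
    · rintro (a | a) (b | b)
      · exact Sum.liftRel_inl_inl.trans ((e.vert_iff a b).trans Sum.liftRel_inl_inl.symm)
      · exact ⟨fun h => (Sum.not_liftRel_inl_inr h).elim,
          fun h => (Sum.not_liftRel_inl_inr h).elim⟩
      · exact ⟨fun h => (Sum.not_liftRel_inr_inl h).elim,
          fun h => (Sum.not_liftRel_inr_inl h).elim⟩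
      · exact Sum.liftRel_inr_inr.trans ((f.vert_iff a b).trans Sum.liftRel_inr_inr.symm)
    · rintro (a | a)
      · exact congrArg Sum.inl (e.map_flip a)
      · exact congrArg Sum.inr (f.map_flip a)
    · rintro (a | a)
      · exact e.mem_F_iff a
      · exact f.mem_F_iff a)
  one := Quotient.mk _ ⟨MarkedGraph.empty, MarkedGraph.isCorePair_empty k⟩
  mul_assoc := by
    rintro ⟨P⟩ ⟨Q⟩ ⟨R⟩
    refine Quotient.sound ⟨⟨Equiv.sumAssoc _ _ _, ?_, ?_, ?_⟩⟩
    · have key : ∀ a b : (P.1.H ⊕ Q.1.H) ⊕ R.1.H,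
          Sum.LiftRel P.1.vert (Sum.LiftRel Q.1.vert R.1.vert)
            (Equiv.sumAssoc _ _ _ a) (Equiv.sumAssoc _ _ _ b) ↔
          Sum.LiftRel (Sum.LiftRel P.1.vert Q.1.vert) R.1.vert a b := by
        rintro ((a | a) | a) ((b | b) | b) <;> simp
      exact key
    · rintro ((a | a) | a) <;> rfl
    · rintro ((a | a) | a) <;> exact Iff.rfl
  one_mul := by
    rintro ⟨P⟩
    refine Quotient.sound ⟨⟨Equiv.emptySum Empty _, ?_, ?_, ?_⟩⟩
    · rintro (a | a) (b | b)
      · exact a.elim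
      · exact a.elim
      · exact b.elim
      · exact Sum.liftRel_inr_inr.symm
    · rintro (a | a)
      · exact a.elim
      · rfl
    · rintro (a | a)
      · exact a.elim
      · exact Iff.rfl
  mul_one := by
    rintro ⟨P⟩
    refine Quotient.sound ⟨⟨Equiv.sumEmpty _ Empty, ?_, ?_, ?_⟩⟩
    · rintro (a | a) (b | b)
      · exact Sum.liftRel_inl_inl.symm
      · exact b.elim
      · exact a.elim
      · exact a.elim
    · rintro (a | a)
      · rfl
      · exact a.elim
    · rintro (a | a)
      · exact Iff.rfl
      · exact a.elim
  mul_comm := by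
    rintro ⟨P⟩ ⟨Q⟩
    refine Quotient.sound ⟨⟨Equiv.sumComm _ _, ?_, ?_, ?_⟩⟩
    · rintro (a | a) (b | b)
      · exact Sum.liftRel_inr_inr.trans Sum.liftRel_inl_inl.symm
      · exact ⟨fun h => (Sum.not_liftRel_inr_inl h).elim,
          fun h => (Sum.not_liftRel_inl_inr h).elim⟩
      · exact ⟨fun h => (Sum.not_liftRel_inl_inr h).elim,
          fun h => (Sum.not_liftRel_inr_inl h).elim⟩
      · exact Sum.liftRel_inl_inl.trans Sum.liftRel_inr_inr.symm
    · rintro (a | a) <;> rfl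
    · rintro (a | a) <;> exact Iff.rfl

/-- The vector space over `ℚ` with basis the isomorphism classes of pairs `(G, F)`, with the
product that is the bilinear extension of the disjoint union. -/
def HGF (k : ℕ) : Type 1 := MonoidAlgebra ℚ (GFClass k)

noncomputable instance HGF.commRing (k : ℕ) : CommRing (HGF k) :=
  inferInstanceAs (CommRing (MonoidAlgebra ℚ (GFClass k)))

/-- The `ℚ`-algebra structure of the monoid algebra. It is not an instance, since the structure of
a Hopf algebra contains the structure of an algebra. -/
@[reducible] noncomputable def HGF.algebra (k : ℕ) : Algebra ℚ (HGF k) :=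
  inferInstanceAs (Algebra ℚ (MonoidAlgebra ℚ (GFClass k)))

/-- The basis element given by the isomorphism class of a pair. -/
noncomputable def HGF.gen {k : ℕ} (P : CorePair k) : HGF k :=
  MonoidAlgebra.of ℚ (GFClass k) (Quotient.mk _ P)

namespace CorePair

variable {k : ℕ}

/-- `X` is the set of edges of a core subgraph `g`, neither empty nor all of `G`, such that
`(g, F ∩ g)` and `(G / g, F - (F ∩ g))` are pairs of a core graph and a spanning forest. -/
structure IsProperCoreSubgraph (P : CorePair k) (X : Set P.1.H) : Prop where
  edges : P.1.IsEdgeSet X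
  nonempty : X.Nonempty
  proper : X ≠ P.1.internal
  sub : (P.1.sub X edges).IsCorePair k
  contract : (P.1.contract X edges).IsCorePair k

/-- The index set of the reduced coproduct: the proper core subgraphs `g` such that
`(G, F)` and `(G / g, F - (F ∩ g))` induce the same partition of the legs, where also the trees
without legs are counted, as empty parts. -/
def CoproductIndex (P : CorePair k) : Type :=
  {X : Set P.1.H // ∃ h : P.IsProperCoreSubgraph X,
    P.1.SameLegPartition X h.edges ∧ P.1.SameTreeNumber X h.edges}

noncomputable instance (P : CorePair k) : Fintype P.CoproductIndex := by
  have := P.1.finite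
  have : Finite P.CoproductIndex := Subtype.finite
  exact Fintype.ofFinite _

/-- The pair `(g, F ∩ g)`. -/
noncomputable def subPair (P : CorePair k) {X : Set P.1.H} (h : P.IsProperCoreSubgraph X) :
    CorePair k := ⟨P.1.sub X h.edges, h.sub⟩

/-- The pair `(G / g, F - (F ∩ g))`. -/
def quotPair (P : CorePair k) {X : Set P.1.H} (h : P.IsProperCoreSubgraph X) :
    CorePair k := ⟨P.1.contract X h.edges, h.contract⟩

/-- `(G, F) ⊗ 𝕀 + 𝕀 ⊗ (G, F) + ∑_g (g, F ∩ g) ⊗ (G / g, F - (F ∩ g))`. -/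
noncomputable def coproduct [Algebra ℚ (HGF k)] (P : CorePair k) :
    HGF k ⊗[ℚ] HGF k :=
  HGF.gen P ⊗ₜ[ℚ] 1 + 1 ⊗ₜ[ℚ] HGF.gen P +
    ∑ X : P.CoproductIndex,
      HGF.gen (P.subPair X.2.choose) ⊗ₜ[ℚ] HGF.gen (P.quotPair X.2.choose)

end CorePair

/-- The part of loop number `j`: the span of the pairs `(G, F)` with `|G| = j`. -/
noncomputable def HGF.degreePart (k : ℕ) [Algebra ℚ (HGF k)] (j : ℕ) : Submodule ℚ (HGF k) :=
  Submodule.span ℚ {x | ∃ P : CorePair k, P.1.loopNumber = j ∧ x = HGF.gen P}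

/-! The coproduct of a connected pair is first rewritten as a single sum over edge sets `X`,
including `∅` and the set of all internal edges. Since `F` has no cycles, `F - (F ∩ g)` is a forest
of `G / g` with as many trees as `F` exactly when `F ∩ g` spans every component of `g`. This form of
the condition, together with bridgelessness of `g` and the valences of `G / g`, can be tested at one
half-edge at a time (`AdmissibleAt`) and sees only the connected component of that half-edge.
Components of `G` that `X` swallows completely disappear from the quotient, so no spanning or
valence condition is imposed on them; `IsActive` singles out the others. Hence the full edge set is
always admissible, the sum makes sense for disconnected graphs, and it is multiplicative under
disjoint union (`coproductSum_disjUnion`). For connected graphs it is the prescribed coproduct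
(`admissible_iff_of_isConnected`, `coproductSum_eq_coproduct`).

Subgraphs and quotients are both instances of minors `P.minor Y X`: contract `Y`, keep the edges of
`X \ Y`. A minor of a minor is a minor (`nonempty_iso_minor_minor`), and admissible sets of the
subgraph on `X`, or of the quotient by `Y`, correspond to the admissible sets of `P` inside `X`, or
containing `Y` (`admissible_sub_iff`, `admissible_quot_iff`). Both iterated coproducts are therefore
the sum over chains `Y ⊆ X` of admissible sets of `(P.minor ∅ Y) ⊗ (P.minor Y X) ⊗ (P.minor X
P.internal)`, which is coassociativity.

Every nonempty `X` lowers the number of edges of the quotient, so the convolution unit minus the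
identity is locally nilpotent, and its geometric series is the antipode. The grading rests on
additivity of the loop number: edges are split between subgraph and quotient, and the differences of
vertex and component numbers telescope (`numVertices_minor_add`). -/

/-- The equivalence relation on `α` obtained from `r` by gluing along a relation `t` on `β` that
contains the pullback of `r`. -/
def Setoid.glue {α β : Type*} (r : Setoid α) (f : β → α) (t : Setoid β)
    (h : ∀ a b, r (f a) (f b) → t a b) : Setoid α where
  r x y := r x y ∨ ∃ a b, r x (f a) ∧ t a b ∧ r (f b) y
  iseqv :=
    { refl := fun x => Or.inl (r.refl x)
      symm := by
        rintro x y (hxy | ⟨a, b, h1, h2, h3⟩)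
        · exact Or.inl (r.symm hxy)
        · exact Or.inr ⟨b, a, r.symm h3, t.symm h2, r.symm h1⟩
      trans := by
        rintro x y z (hxy | ⟨a, b, h1, h2, h3⟩) (hyz | ⟨c, d, h4, h5, h6⟩)
        · exact Or.inl (r.trans hxy hyz)
        · exact Or.inr ⟨c, d, r.trans hxy h4, h5, h6⟩
        · exact Or.inr ⟨a, b, h1, h2, r.trans h3 hyz⟩
        · exact Or.inr ⟨a, d, h1, t.trans h2 (t.trans (h _ _ (r.trans h3 h4)) h5), h6⟩ }

/-! ### Connectivity along sets of edges -/

namespace FeynmanGraph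

variable {G : FeynmanGraph}

instance instFiniteH (G : FeynmanGraph) : Finite G.H := G.finite

theorem flip_injective : Function.Injective G.flip :=
  Function.LeftInverse.injective G.flip_flip

theorem conn_of_vert {X : Set G.H} {a b : G.H} (h : G.vert a b) : G.conn X a b :=
  Relation.EqvGen.rel _ _ (Or.inl h)

theorem conn_flip {X : Set G.H} {a : G.H} (h : a ∈ X) : G.conn X a (G.flip a) :=
  Relation.EqvGen.rel _ _ (Or.inr ⟨h, rfl⟩)

/-- The universal property of `conn X` as a generated equivalence relation. It replaces induction
along paths in most of what follows. -/
theorem conn_le {X : Set G.H} {r : Setoid G.H} (hv : ∀ a b, G.vert a b → r a b)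
    (hf : ∀ a ∈ X, r a (G.flip a)) {a b : G.H} (h : G.conn X a b) : r a b := by
  refine (Setoid.eqvGen_le (s := r) ?_ : G.conn X ≤ r) h
  rintro x y (h | ⟨h, rfl⟩)
  · exact hv _ _ h
  · exact hf _ h

theorem conn_mono {X Y : Set G.H} (hXY : X ⊆ Y) {a b : G.H} (h : G.conn X a b) : G.conn Y a b :=
  conn_le (r := G.conn Y) (fun _ _ => conn_of_vert) (fun _ ha => conn_flip (hXY ha)) h

theorem conn_empty {a b : G.H} : G.conn ∅ a b ↔ G.vert a b :=
  ⟨conn_le (fun _ _ h => h) (fun _ h => h.elim), conn_of_vert⟩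

/-- On a union of vertices that is closed under the edges in `X`, the relation `conn X` is
contained in any equivalence relation that contains its generators there. -/
theorem conn_le_on {X C : Set G.H} {r : Setoid G.H} (hCv : ∀ a b, G.vert a b → a ∈ C → b ∈ C)
    (hCf : ∀ a ∈ X, (a ∈ C ↔ G.flip a ∈ C)) (hv : ∀ a b, G.vert a b → r a b)
    (hf : ∀ a ∈ X, a ∈ C → r a (G.flip a)) {a b : G.H} (ha : a ∈ C) (h : G.conn X a b) :
    r a b := by
  let s : Setoid G.H :=
    { r := fun x y => (x ∈ C ↔ y ∈ C) ∧ (x ∈ C → r x y)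
      iseqv :=
        { refl := fun x => ⟨Iff.rfl, fun _ => r.refl x⟩
          symm := fun h => ⟨h.1.symm, fun hy => r.symm (h.2 (h.1.2 hy))⟩
          trans := fun h h' => ⟨h.1.trans h'.1, fun hx => r.trans (h.2 hx) (h'.2 (h.1.1 hx))⟩ } }
  have key : s a b := conn_le (r := s)
    (fun x y hxy => ⟨⟨hCv _ _ hxy, hCv _ _ (G.vert.symm hxy)⟩, fun _ => hv _ _ hxy⟩)
    (fun x hx => ⟨hCf x hx, hf x hx⟩) h
  exact key.2 ha

/-- A set of half-edges that is closed under the generators is closed under `conn X`. -/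
theorem conn_mem {X C : Set G.H} (hCv : ∀ a b, G.vert a b → a ∈ C → b ∈ C)
    (hCf : ∀ a ∈ X, (a ∈ C ↔ G.flip a ∈ C)) {a b : G.H} (h : G.conn X a b) (ha : a ∈ C) :
    b ∈ C := by
  have key : (Setoid.ker (· ∈ C)) a b := conn_le (r := Setoid.ker (· ∈ C))
    (fun x y hxy => propext ⟨hCv _ _ hxy, hCv _ _ (G.vert.symm hxy)⟩)
    (fun x hx => propext (hCf x hx)) h
  exact (iff_of_eq key).1 ha

/-- A path can be shortened so that it avoids the edge of `e` or crosses it once, in one of the two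
directions. Gluing the two ends of the edge onto the relation without it gives an equivalence
relation that contains all generators. -/
theorem conn_insert_edge {Z : Set G.H} {e a b : G.H} (h : G.conn Z a b) :
    G.conn (Z \ {e, G.flip e}) a b ∨
      (G.conn (Z \ {e, G.flip e}) a e ∧ G.conn (Z \ {e, G.flip e}) (G.flip e) b) ∨
      (G.conn (Z \ {e, G.flip e}) a (G.flip e) ∧ G.conn (Z \ {e, G.flip e}) e b) := by
  set r := G.conn (Z \ {e, G.flip e})
  have key : r.glue (fun i : Bool => cond i e (G.flip e)) ⊤ (fun _ _ _ => trivial) a b := by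
    refine conn_le (fun x y hxy => Or.inl (conn_of_vert hxy)) (fun x hx => ?_) h
    by_cases hxe : x = e
    · subst hxe
      exact Or.inr ⟨true, false, r.refl _, trivial, r.refl _⟩
    by_cases hxe' : x = G.flip e
    · subst hxe'
      refine Or.inr ⟨false, true, r.refl _, trivial, ?_⟩
      rw [G.flip_flip]
      exact r.refl _
    · exact Or.inl (conn_flip ⟨hx, by simp [hxe, hxe']⟩)
  rcases key with h | ⟨i, j, h1, -, h2⟩
  · exact Or.inl h
  · cases i <;> cases j
    · exact Or.inl (r.trans h1 h2)
    · exact Or.inr (Or.inr ⟨h1, h2⟩)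
    · exact Or.inr (Or.inl ⟨h1, h2⟩)
    · exact Or.inl (r.trans h1 h2)

/-- If the vertices of `R` are obtained by joining half-edges of `G` along edges in `Y`, then paths
in `G` along `Y ∪ Z` either stay in `Y` or come from paths in `R` along `Z`. -/
theorem conn_union_cases {R : FeynmanGraph} (f : R.H → G.H) {Y : Set G.H} {Z : Set R.H}
    (hv : ∀ a b, G.conn Y (f a) (f b) → R.vert a b)
    (hf : ∀ a ∈ Z, f (R.flip a) = G.flip (f a)) {x y : G.H} (h : G.conn (Y ∪ f '' Z) x y) :
    G.conn Y x y ∨ ∃ a b, G.conn Y x (f a) ∧ R.conn Z a b ∧ G.conn Y (f b) y := by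
  have key : (G.conn Y).glue f (R.conn Z) (fun a b h => conn_of_vert (hv a b h)) x y := by
    refine conn_le (fun x y hxy => Or.inl (conn_of_vert hxy)) (fun x hx => ?_) h
    rcases hx with hx | ⟨a, ha, rfl⟩
    · exact Or.inl (conn_flip hx)
    · refine Or.inr ⟨a, R.flip a, Setoid.refl' _ _, conn_flip ha, ?_⟩
      rw [hf a ha]
  exact key

/-- Contraction in stages: if the vertices of `R` are cut out by the components of `(G, Y)`, then
joining by `Z` in `R` is joining by `Y` and `Z` together in `G`. Minors and `contract` are both
treated through this. -/
theorem conn_iff_of_vert {R : FeynmanGraph} (f : R.H → G.H) {Y : Set G.H} {Z : Set R.H}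
    (hv : ∀ a b, R.vert a b ↔ G.conn Y (f a) (f b))
    (hf : ∀ a ∈ Z, f (R.flip a) = G.flip (f a)) {a b : R.H} :
    R.conn Z a b ↔ G.conn (Y ∪ f '' Z) (f a) (f b) := by
  constructor
  · intro h
    refine conn_le (r := (G.conn (Y ∪ f '' Z)).comap f) (fun x y hxy => ?_) (fun x hx => ?_) h
    · exact conn_mono Set.subset_union_left ((hv x y).1 hxy)
    · change G.conn _ (f x) (f (R.flip x))
      rw [hf x hx]
      exact conn_flip (Or.inr ⟨x, hx, rfl⟩)
  · intro h
    rcases conn_union_cases f (fun a b => (hv a b).2) hf h with h | ⟨c, d, h1, h2, h3⟩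
    · exact conn_of_vert ((hv _ _).2 h)
    · exact Setoid.trans' _ (conn_of_vert ((hv _ _).2 h1))
        (Setoid.trans' _ h2 (conn_of_vert ((hv _ _).2 h3)))

theorem IsEdgeSet.flip_mem_iff {X : Set G.H} (hX : G.IsEdgeSet X) {h : G.H} :
    G.flip h ∈ X ↔ h ∈ X :=
  ⟨fun hh => by simpa [G.flip_flip] using (hX _ hh).1, fun hh => (hX _ hh).1⟩

theorem IsEdgeSet.subset_internal {X : Set G.H} (hX : G.IsEdgeSet X) : X ⊆ G.internal :=
  fun _ hh => (hX _ hh).2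

theorem isEdgeSet_empty : G.IsEdgeSet ∅ := fun _ h => h.elim

theorem isEdgeSet_internal : G.IsEdgeSet G.internal := fun _ hh =>
  ⟨fun e => hh (flip_injective e), hh⟩

/-- The half-edge `h` lies in a part of the graph `(G, X)` from which an internal edge that is not
in `X` starts. -/
def IsActive (G : FeynmanGraph) (X : Set G.H) (h : G.H) : Prop :=
  ∃ x ∈ G.internal, x ∉ X ∧ G.conn X h x

theorem IsActive.conn {X : Set G.H} {a b : G.H} (ha : G.IsActive X a) (h : G.conn X a b) :
    G.IsActive X b :=
  let ⟨x, hx, hxX, hax⟩ := ha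
  ⟨x, hx, hxX, Setoid.trans' _ (Setoid.symm' _ h) hax⟩

/-- An edge in `X` joins its two ends, and an edge outside `X` makes both ends active. So activity
passes across every internal edge, which makes it constant on connected components of the graph. -/
theorem isActive_flip_iff {X : Set G.H} (hX : G.IsEdgeSet X) {a : G.H} (ha : a ∈ G.internal) :
    G.IsActive X a ↔ G.IsActive X (G.flip a) := by
  by_cases haX : a ∈ X
  · exact ⟨fun h => h.conn (conn_flip haX), fun h => h.conn (Setoid.symm' _ (conn_flip haX))⟩
  · exact iff_of_true ⟨a, ha, haX, Setoid.refl' _ _⟩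
      ⟨_, (isEdgeSet_internal a ha).1, fun h => haX (hX.flip_mem_iff.1 h), Setoid.refl' _ _⟩

/-- Being active only depends on the connected component of the graph. -/
theorem IsActive.conn_internal {X : Set G.H} (hX : G.IsEdgeSet X) {a b : G.H}
    (ha : G.IsActive X a) (h : G.conn G.internal a b) : G.IsActive X b :=
  conn_mem (C := {a | G.IsActive X a}) (fun _ _ h ha => ha.conn (conn_of_vert h))
    (fun _ ha => isActive_flip_iff hX ha) h ha

theorem IsActive.anti {X Y : Set G.H} (hY : G.IsEdgeSet Y) (hYX : Y ⊆ X) {a : G.H}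
    (ha : G.IsActive X a) (hX : G.IsEdgeSet X) : G.IsActive Y a := by
  obtain ⟨x, hx, hxX, hax⟩ := ha
  exact IsActive.conn_internal hY ⟨x, hx, fun h => hxX (hYX h), Setoid.refl' _ _⟩
    (conn_mono hX.subset_internal (Setoid.symm' _ hax))

end FeynmanGraph

/-! ### Minors of pairs -/

namespace MarkedGraph

open FeynmanGraph

variable {P : MarkedGraph}

open Classical in
/-- The minor of `P` with set of internal edges `X \ Y`, where the edges in `Y` are contracted.
Its vertices are those that are met by an edge of `X \ Y`. -/
noncomputable def minor (P : MarkedGraph) (Y X : Set P.H) : MarkedGraph where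
  H := {h : P.H // h ∉ Y ∧ ∃ x ∈ X \ Y, P.conn Y h x}
  finite := by infer_instance
  vert := (P.conn Y).comap Subtype.val
  flip h := if hh : h.1 ∈ X ∧ P.flip h.1 ∈ X \ Y then
    ⟨P.flip h.1, hh.2.2, _, hh.2, Setoid.refl' _ _⟩ else h
  flip_flip h := by
    by_cases hh : h.1 ∈ X ∧ P.flip h.1 ∈ X \ Y
    · simp [hh.1, hh.2.1, hh.2.2, P.flip_flip, h.2.1]
    · simp only [dif_neg hh]
  F := {h | h.1 ∈ P.F ∩ X}

/-- The inclusion of the half-edges of a minor. -/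
def minorVal (P : MarkedGraph) (Y X : Set P.H) (h : (P.minor Y X).H) : P.H := h.1

section minor

variable {Y X W : Set P.H}

theorem minorVal_injective : Function.Injective (P.minorVal Y X) := Subtype.val_injective

theorem minorVal_notMem (h : (P.minor Y X).H) : P.minorVal Y X h ∉ Y := h.2.1

theorem exists_minorVal_eq {h x : P.H} (hY : h ∉ Y) (hx : x ∈ X) (hxY : x ∉ Y)
    (hc : P.conn Y h x) : ∃ a, P.minorVal Y X a = h :=
  ⟨⟨h, hY, x, ⟨hx, hxY⟩, hc⟩, rfl⟩

theorem exists_minorVal_eq_of_mem {h : P.H} (hX : h ∈ X) (hY : h ∉ Y) :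
    ∃ a, P.minorVal Y X a = h :=
  exists_minorVal_eq hY hX hY (Setoid.refl' _ _)

theorem exists_conn_minorVal (a : (P.minor Y X).H) :
    ∃ x ∈ X, x ∉ Y ∧ P.conn Y (P.minorVal Y X a) x := by
  obtain ⟨-, x, hx, hc⟩ := a.2
  exact ⟨x, hx.1, hx.2, hc⟩

theorem minor_vert {a b : (P.minor Y X).H} :
    (P.minor Y X).vert a b ↔ P.conn Y (P.minorVal Y X a) (P.minorVal Y X b) := Iff.rfl

theorem mem_minor_F {a : (P.minor Y X).H} :
    a ∈ (P.minor Y X).F ↔ P.minorVal Y X a ∈ P.F ∩ X := Iff.rfl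

theorem minorVal_flip (hX : P.IsEdgeSet X) (hY : P.IsEdgeSet Y) {a : (P.minor Y X).H}
    (ha : P.minorVal Y X a ∈ X) :
    P.minorVal Y X ((P.minor Y X).flip a) = P.flip (P.minorVal Y X a) := by
  have h : a.1 ∈ X ∧ P.flip a.1 ∈ X \ Y :=
    ⟨ha, (hX _ ha).1, fun h => a.2.1 (hY.flip_mem_iff.1 h)⟩
  exact congrArg Subtype.val (dif_pos h)

theorem minor_flip_of_notMem {a : (P.minor Y X).H} (ha : P.minorVal Y X a ∉ X) :
    (P.minor Y X).flip a = a := by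
  have h : ¬ (a.1 ∈ X ∧ P.flip a.1 ∈ X \ Y) := fun h => ha h.1
  exact dif_neg h

theorem internal_minor (hX : P.IsEdgeSet X) (hY : P.IsEdgeSet Y) :
    (P.minor Y X).internal = P.minorVal Y X ⁻¹' X := by
  ext a
  constructor
  · intro h
    by_contra ha
    exact h (minor_flip_of_notMem ha)
  · intro ha h
    exact (hX _ ha).2 (by rw [← minorVal_flip hX hY ha, h])

/-- Together with `preimage_union_image_minorVal` this shows that taking preimages loses nothing for
sets between `Y` and `X`; the inverse is image followed by union with `Y`. -/
theorem union_image_minorVal (hYW : Y ⊆ W) (hWX : W ⊆ X) :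
    Y ∪ P.minorVal Y X '' (P.minorVal Y X ⁻¹' W) = W := by
  ext x
  constructor
  · rintro (h | ⟨a, ha, rfl⟩)
    · exact hYW h
    · exact ha
  · intro h
    by_cases hY : x ∈ Y
    · exact Or.inl hY
    · obtain ⟨a, rfl⟩ := exists_minorVal_eq_of_mem (hWX h) hY
      exact Or.inr ⟨a, h, rfl⟩

theorem preimage_union_image_minorVal (Z : Set (P.minor Y X).H) :
    P.minorVal Y X ⁻¹' (Y ∪ P.minorVal Y X '' Z) = Z := by
  ext a
  constructor
  · rintro (h | ⟨b, hb, hab⟩)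
    · exact absurd h (minorVal_notMem a)
    · exact minorVal_injective hab ▸ hb
  · intro h
    exact Or.inr ⟨a, h, rfl⟩

theorem minor_conn (hX : P.IsEdgeSet X) (hY : P.IsEdgeSet Y) (hYW : Y ⊆ W) (hWX : W ⊆ X)
    {a b : (P.minor Y X).H} :
    (P.minor Y X).conn (P.minorVal Y X ⁻¹' W) a b ↔
      P.conn W (P.minorVal Y X a) (P.minorVal Y X b) := by
  have h := conn_iff_of_vert (R := (P.minor Y X).toFeynmanGraph) (P.minorVal Y X) (Y := Y)
    (Z := P.minorVal Y X ⁻¹' W) (a := a) (b := b) (fun _ _ => Iff.rfl)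
    (fun a ha => minorVal_flip hX hY (hWX ha))
  rwa [union_image_minorVal hYW hWX] at h

theorem isEdgeSet_minor_iff (hX : P.IsEdgeSet X) (hY : P.IsEdgeSet Y) (hYW : Y ⊆ W)
    (hWX : W ⊆ X) : (P.minor Y X).IsEdgeSet (P.minorVal Y X ⁻¹' W) ↔ P.IsEdgeSet W := by
  constructor
  · intro h x hx
    by_cases hxY : x ∈ Y
    · exact ⟨hYW (hY x hxY).1, (hY x hxY).2⟩
    · obtain ⟨a, rfl⟩ := exists_minorVal_eq_of_mem (hWX hx) hxY
      have := (h a hx).1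
      rw [Set.mem_preimage, minorVal_flip hX hY (hWX hx)] at this
      exact ⟨this, (hX _ (hWX hx)).2⟩
  · intro h a ha
    rw [Set.mem_preimage, minorVal_flip hX hY (hWX ha)]
    refine ⟨(h _ ha).1, ?_⟩
    have : a ∈ (P.minor Y X).internal := by
      rw [internal_minor hX hY]
      exact hWX ha
    exact this

/-- Isomorphisms that are given by compatible injections into the same set. -/
theorem nonempty_iso_of_maps {P Q : MarkedGraph} {α : Type*} (f : P.H → α) (g : Q.H → α)
    (hf : Function.Injective f) (hg : Function.Injective g) (hfg : ∀ a, ∃ b, g b = f a)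
    (hgf : ∀ b, ∃ a, f a = g b)
    (hv : ∀ a b a' b', g a' = f a → g b' = f b → (Q.vert a' b' ↔ P.vert a b))
    (hflip : ∀ a a', g a' = f a → g (Q.flip a') = f (P.flip a))
    (hF : ∀ a a', g a' = f a → (a' ∈ Q.F ↔ a ∈ P.F)) : Nonempty (Iso P Q) := by
  choose u hu using hfg
  choose v hv' using hgf
  refine ⟨⟨⟨u, v, fun a => hf (by rw [hv', hu]), fun b => hg (by rw [hu, hv'])⟩,
    fun a b => hv a b _ _ (hu a) (hu b), fun a => hg ?_, fun a => hF _ _ (hu a)⟩⟩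
  change g (u _) = g (Q.flip (u a))
  rw [hflip _ _ (hu a), hu]

/-- A minor of a minor is a minor. -/
theorem nonempty_iso_minor_minor {Y' X' : Set P.H} (hX : P.IsEdgeSet X) (hY : P.IsEdgeSet Y)
    (hX' : P.IsEdgeSet X') (hY' : P.IsEdgeSet Y') (hYY : Y ⊆ Y') (hYX' : Y' ⊆ X') (hXX : X' ⊆ X) :
    Nonempty (Iso ((P.minor Y X).minor (P.minorVal Y X ⁻¹' Y') (P.minorVal Y X ⁻¹' X'))
      (P.minor Y' X')) := by
  have hX'R := (isEdgeSet_minor_iff hX hY (hYY.trans hYX') hXX).2 hX'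
  have hY'R := (isEdgeSet_minor_iff hX hY hYY (hYX'.trans hXX)).2 hY'
  set R := P.minor Y X
  set f := P.minorVal Y X
  set g := R.minorVal (f ⁻¹' Y') (f ⁻¹' X')
  have hmem : ∀ a, (∃ b, f (g b) = a) ↔ a ∉ Y' ∧ ∃ x ∈ X', x ∉ Y' ∧ P.conn Y' a x := by
    intro a
    constructor
    · rintro ⟨b, rfl⟩
      obtain ⟨x, hx, hxY, hc⟩ := exists_conn_minorVal b
      exact ⟨minorVal_notMem b, f x, hx, hxY, (minor_conn hX hY hYY (hYX'.trans hXX)).1 hc⟩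
    · rintro ⟨ha, x, hx, hxY, hc⟩
      obtain ⟨y, rfl⟩ := exists_minorVal_eq_of_mem (Y := Y) (hXX hx) (fun h => hxY (hYY h))
      have : ∃ z, f z = a := by
        have haY : a ∉ Y := fun h => ha (hYY h)
        have hc' := hc
        rw [← union_image_minorVal hYY (hYX'.trans hXX)] at hc'
        rcases conn_union_cases (R := R.toFeynmanGraph) f (fun a b h => minor_vert.2 h)
          (fun a ha => minorVal_flip hX hY (hXX (hYX' ha))) hc' with h | ⟨c, d, h1, h2, h3⟩
        · exact exists_minorVal_eq haY (hXX hx) (fun h => hxY (hYY h)) h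
        · obtain ⟨w, hw, hwY, hcw⟩ := exists_conn_minorVal c
          exact exists_minorVal_eq haY hw hwY (Setoid.trans' _ h1 hcw)
      obtain ⟨z, rfl⟩ := this
      obtain ⟨b, rfl⟩ := exists_minorVal_eq (P := R) (Y := f ⁻¹' Y') (X := f ⁻¹' X')
        (h := z) (x := y) ha hx hxY ((minor_conn hX hY hYY (hYX'.trans hXX)).2 hc)
      exact ⟨b, rfl⟩
  refine nonempty_iso_of_maps (fun a => f (g a)) (P.minorVal Y' X')
    (minorVal_injective.comp minorVal_injective) minorVal_injective ?_ ?_ ?_ ?_ ?_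
  · intro a
    obtain ⟨ha, x, hx, hxY, hc⟩ := (hmem _).1 ⟨a, rfl⟩
    exact exists_minorVal_eq ha hx hxY hc
  · intro b
    exact (hmem _).2 ⟨minorVal_notMem b, exists_conn_minorVal b⟩
  · intro a b a' b' ha hb
    rw [minor_vert, minor_vert, minor_conn hX hY hYY (hYX'.trans hXX), ha, hb]
  · intro a a' ha
    by_cases haX : f (g a) ∈ X'
    · have h1 : g ((R.minor (f ⁻¹' Y') (f ⁻¹' X')).flip a) = R.flip (g a) :=
        minorVal_flip hX'R hY'R haX
      have h2 : f (R.flip (g a)) = P.flip (f (g a)) := minorVal_flip hX hY (hXX haX)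
      rw [minorVal_flip hX' hY' (ha ▸ haX), h1, h2, ha]
    · rw [minor_flip_of_notMem (ha ▸ haX), minor_flip_of_notMem haX, ha]
  · intro a a' ha
    rw [mem_minor_F, mem_minor_F, ha]
    constructor
    · exact fun h => ⟨⟨h.1, hXX h.2⟩, h.2⟩
    · exact fun h => ⟨h.1.1, h.2⟩

end minor

/-! ### Admissible sets of edges -/

variable {k : ℕ}

/-- The local form at a half-edge `h` of the condition that `X` is the set of edges of a bridgeless
subgraph, such that the forest spans the components of this subgraph and its contraction has
valences at least `k`. Nothing is required of the components of the graph that are contained in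
the subgraph. -/
structure AdmissibleAt (k : ℕ) (P : MarkedGraph) (X : Set P.H) (h : P.H) : Prop where
  flip_mem : h ∈ X → P.flip h ∈ X
  flip_ne : h ∈ X → P.flip h ≠ h
  bridgeless : h ∈ X → P.conn (X \ {h, P.flip h}) h (P.flip h)
  spans : P.IsActive X h → ∀ a, P.conn X h a → P.conn (P.F ∩ X) h a
  valence : P.IsActive X h → k ≤ Nat.card {y // y ∉ X ∧ P.conn X h y}

/-- The sets of edges that contribute to the coproduct. -/
def Admissible (k : ℕ) (P : MarkedGraph) (X : Set P.H) : Prop := ∀ h, AdmissibleAt k P X h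

theorem Admissible.edges {X : Set P.H} (h : Admissible k P X) : P.IsEdgeSet X :=
  fun a ha => ⟨(h a).flip_mem ha, (h a).flip_ne ha⟩

section minor

variable {X Y W : Set P.H}

/-- A minor lacks the vertices not met by `X \ Y`, so equality of valences needs `hW`: no half-edge
of the contracted vertex may be lost. -/
theorem card_minor_valence {h : (P.minor Y X).H} {W : Set P.H}
    (hW : ∀ h', h' ∉ W → P.conn W (P.minorVal Y X h) h' → ∃ a, P.minorVal Y X a = h')
    (hconn : ∀ a, (P.minor Y X).conn (P.minorVal Y X ⁻¹' W) h a ↔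
      P.conn W (P.minorVal Y X h) (P.minorVal Y X a)) :
    Nat.card {h' // h' ∉ P.minorVal Y X ⁻¹' W ∧
      (P.minor Y X).conn (P.minorVal Y X ⁻¹' W) h h'} =
    Nat.card {h' // h' ∉ W ∧ P.conn W (P.minorVal Y X h) h'} := by
  refine Nat.card_congr (Equiv.ofBijective
    (fun a => ⟨P.minorVal Y X a.1, a.2.1, (hconn _).1 a.2.2⟩) ⟨?_, ?_⟩)
  · intro a b hab
    exact Subtype.ext (minorVal_injective (congrArg (fun x => x.1) hab))
  · rintro ⟨h', h1, h2⟩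
    obtain ⟨a, rfl⟩ := hW h' h1 h2
    exact ⟨⟨a, h1, (hconn _).2 h2⟩, rfl⟩

/-- The deleted edge is not in `Y`, so the remaining edges of `W` still contain `Y` and `minor_conn`
applies. The same equivalence serves bridgelessness and, negated, acyclicity. -/
theorem minor_bridgeless_iff (hX : P.IsEdgeSet X) (hY : P.IsEdgeSet Y) (hYW : Y ⊆ W)
    (hWX : W ⊆ X) {h : (P.minor Y X).H} (hh : P.minorVal Y X h ∈ W) :
    (P.minor Y X).conn (P.minorVal Y X ⁻¹' W \ {h, (P.minor Y X).flip h}) h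
      ((P.minor Y X).flip h) ↔
    P.conn (W \ {P.minorVal Y X h, P.flip (P.minorVal Y X h)}) (P.minorVal Y X h)
      (P.flip (P.minorVal Y X h)) := by
  have hf := minorVal_flip hX hY (hWX hh)
  have e : P.minorVal Y X ⁻¹' W \ {h, (P.minor Y X).flip h} =
      P.minorVal Y X ⁻¹' (W \ {P.minorVal Y X h, P.flip (P.minorVal Y X h)}) := by
    ext a
    simp [← hf, minorVal_injective.eq_iff]
  rw [e, minor_conn hX hY _ (Set.sdiff_subset.trans hWX), hf]
  intro y hy
  refine ⟨hYW hy, ?_⟩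
  rintro (rfl | h')
  · exact minorVal_notMem _ hy
  · rw [Set.mem_singleton_iff] at h'
    subst h'
    exact minorVal_notMem _ (hY.flip_mem_iff.1 hy)

theorem isActive_minor_iff (hX : P.IsEdgeSet X) (hY : P.IsEdgeSet Y) (hYW : Y ⊆ W)
    (hWX : W ⊆ X) {h : (P.minor Y X).H} :
    (P.minor Y X).IsActive (P.minorVal Y X ⁻¹' W) h ↔
      ∃ x ∈ X, x ∉ W ∧ P.conn W (P.minorVal Y X h) x := by
  unfold IsActive
  rw [internal_minor hX hY]
  constructor
  · rintro ⟨x, hx, hxW, hc⟩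
    exact ⟨_, hx, hxW, (minor_conn hX hY hYW hWX).1 hc⟩
  · rintro ⟨x, hx, hxW, hc⟩
    obtain ⟨a, rfl⟩ := exists_minorVal_eq_of_mem (Y := Y) hx (fun h => hxW (hYW h))
    exact ⟨a, hx, hxW, (minor_conn hX hY hYW hWX).2 hc⟩

/-- When a minor is a pair of a core graph and a spanning forest. -/
theorem isCorePair_minor (hX : P.IsEdgeSet X) (hY : P.IsEdgeSet Y) (hYX : Y ⊆ X)
    (hP : P.IsEdgeSet P.F)
    (hb : ∀ h ∈ X, h ∉ Y → P.conn (X \ {h, P.flip h}) h (P.flip h))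
    (hk : ∀ h ∉ Y, (∃ x ∈ X, x ∉ Y ∧ P.conn Y h x) →
      k ≤ Nat.card {h' // h' ∉ Y ∧ P.conn Y h h'})
    (ha : ∀ h ∈ P.F ∩ X, h ∉ Y →
      ¬ P.conn (Y ∪ (P.F ∩ X) \ {h, P.flip h}) h (P.flip h)) :
    IsCorePair k (P.minor Y X) where
  bridgeless h hh := by
    rw [internal_minor hX hY] at hh ⊢
    exact (minor_bridgeless_iff hX hY hYX subset_rfl hh).2 (hb _ hh (minorVal_notMem h))
  no_isolated h := by
    rw [internal_minor hX hY]
    obtain ⟨x, hx, hxY, hc⟩ := exists_conn_minorVal h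
    obtain ⟨a, rfl⟩ := exists_minorVal_eq_of_mem hx hxY
    exact ⟨a, hx, hc⟩
  valence h := by
    obtain ⟨x, hx, hxY, hc⟩ := exists_conn_minorVal h
    have e : ∀ a, ((P.minor Y X).vert h a ↔ a ∉ P.minorVal Y X ⁻¹' Y ∧
        (P.minor Y X).conn (P.minorVal Y X ⁻¹' Y) h a) := by
      intro a
      rw [minor_conn hX hY subset_rfl hYX, minor_vert]
      exact ⟨fun h => ⟨minorVal_notMem a, h⟩, And.right⟩
    rw [Nat.card_congr (Equiv.subtypeEquivRight e), card_minor_valence]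
    · exact hk _ (minorVal_notMem h) ⟨x, hx, hxY, hc⟩
    · exact fun h' h1 h2 => exists_minorVal_eq h1 hx hxY (Setoid.trans' _ (Setoid.symm' _ h2) hc)
    · exact fun a => minor_conn hX hY subset_rfl hYX
  edges h hh := by
    have hf := minorVal_flip hX hY hh.2
    refine ⟨?_, ?_⟩
    · rw [mem_minor_F, hf]
      exact ⟨(hP _ hh.1).1, (hX _ hh.2).1⟩
    · have : h ∈ (P.minor Y X).internal := by
        rw [internal_minor hX hY]
        exact hh.2
      exact this
  acyclic h hh hc := by
    -- No half-edge of the minor lies in `Y`. Adding `Y` therefore does not change the preimage, but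
    -- gives a set above `Y`, as `minor_bridgeless_iff` requires.
    have e : (P.minor Y X).F = P.minorVal Y X ⁻¹' (Y ∪ P.F ∩ X) := by
      ext a
      rw [mem_minor_F, Set.mem_preimage, Set.mem_union]
      exact ⟨Or.inr, fun h => h.resolve_left (minorVal_notMem a)⟩
    rw [e, minor_bridgeless_iff hX hY Set.subset_union_left
      (Set.union_subset hYX Set.inter_subset_right) (Or.inr hh)] at hc
    refine ha _ hh (minorVal_notMem h) (conn_mono ?_ hc)
    rintro x ⟨hx | hx, hx'⟩
    · exact Or.inl hx
    · exact Or.inr ⟨hx, hx'⟩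

end minor

/-! ### Admissible sets of subgraphs and quotients -/

section IsCorePair

variable {X Y : Set P.H}

theorem IsCorePair.card_vert (hP : IsCorePair k P) (h : P.H) :
    k ≤ Nat.card {h' // h' ∉ (∅ : Set P.H) ∧ P.conn ∅ h h'} := by
  refine (hP.valence h).trans_eq (Nat.card_congr (Equiv.subtypeEquivRight fun a => ?_))
  simp [conn_empty]

theorem IsCorePair.isCorePair_sub (hP : IsCorePair k P) (hX : Admissible k P X) :
    IsCorePair k (P.minor ∅ X) := by
  refine isCorePair_minor hX.edges isEdgeSet_empty (Set.empty_subset _) hP.edges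
    (fun h hh _ => (hX h).bridgeless hh) (fun h _ _ => hP.card_vert h) (fun h hh _ hc => ?_)
  refine hP.acyclic h hh.1 (conn_mono ?_ hc)
  rw [Set.empty_union]
  exact Set.sdiff_subset_sdiff_left Set.inter_subset_left

/-- Acyclicity of the contracted forest is the point. Where an edge survives, each edge of `X` can
be replaced by a path in `P.F ∩ X`, which avoids the surviving edge `h`; a cycle through `h` in the
quotient would thus lift to a cycle of `F`. -/
theorem IsCorePair.isCorePair_quot (hP : IsCorePair k P) (hX : Admissible k P X) :
    IsCorePair k (P.minor X P.internal) := by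
  refine isCorePair_minor isEdgeSet_internal hX.edges hX.edges.subset_internal hP.edges
    (fun h hh _ => hP.bridgeless h hh) (fun h hh hx => (hX h).valence ?_) (fun h hh hhX hc => ?_)
  · obtain ⟨x, hx, hxX, hc⟩ := hx
    exact ⟨x, hx, hxX, hc⟩
  -- `spans` is available only at active half-edges, hence the restriction to the set of these. The
  -- path stays there because its start `h` is itself an uncontracted edge.
  · refine hP.acyclic h hh.1 (conn_le_on (C := {a | P.IsActive X a})
      (fun a b hab ha => ha.conn (conn_of_vert hab)) ?_ (fun _ _ => conn_of_vert) ?_ ?_ hc)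
    · rintro a (ha | ha)
      · exact isActive_flip_iff hX.edges (hX.edges.subset_internal ha)
      · exact isActive_flip_iff hX.edges ha.1.2
    · rintro a (ha | ha) hact
      · refine conn_mono ?_ ((hX a).spans hact _ (conn_flip ha))
        refine fun x hx => ⟨hx.1, ?_⟩
        rintro (rfl | h')
        · exact hhX hx.2
        · rw [Set.mem_singleton_iff] at h'
          exact hhX (hX.edges.flip_mem_iff.1 (h' ▸ hx.2))
      · exact conn_flip ⟨ha.1.1, ha.2⟩
    · exact ⟨h, hh.2, hhX, Setoid.refl' _ _⟩

/-- Admissible sets of edges of a subgraph. -/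
theorem admissible_sub_iff (hX : Admissible k P X) (hYX : Y ⊆ X) :
    Admissible k (P.minor ∅ X) (P.minorVal ∅ X ⁻¹' Y) ↔ Admissible k P Y := by
  have hE := hX.edges
  have h0 : P.IsEdgeSet (∅ : Set P.H) := isEdgeSet_empty
  have hs := Set.empty_subset Y
  have hconn : ∀ {W : Set P.H} (_ : W ⊆ X) {a b}, (P.minor ∅ X).conn (P.minorVal ∅ X ⁻¹' W) a b ↔
      P.conn W (P.minorVal ∅ X a) (P.minorVal ∅ X b) :=
    fun hW => minor_conn hE h0 (Set.empty_subset _) hW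
  have hF : (P.minor ∅ X).F ∩ P.minorVal ∅ X ⁻¹' Y = P.minorVal ∅ X ⁻¹' (P.F ∩ Y) := by
    ext a
    simp only [Set.mem_inter_iff, mem_minor_F, Set.mem_preimage]
    exact ⟨fun h => ⟨h.1.1, h.2⟩, fun h => ⟨⟨h.1, hYX h.2⟩, h.2⟩⟩
  have hFX : P.F ∩ Y ⊆ X := Set.inter_subset_right.trans hYX
  -- the half-edges of the vertices that are met by `X`
  have hC : ∀ {a b}, (∃ c, P.minorVal ∅ X c = a) → P.conn Y a b → ∃ c, P.minorVal ∅ X c = b := by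
    intro a b ha hab
    refine conn_mem (C := {b | ∃ c, P.minorVal ∅ X c = b}) ?_ ?_ hab ha
    · rintro _ y hxy ⟨c, rfl⟩
      obtain ⟨x, hx, -, hc⟩ := exists_conn_minorVal c
      exact exists_minorVal_eq (Set.notMem_empty _) hx (Set.notMem_empty _)
        (Setoid.trans' _ (Setoid.symm' _ (conn_of_vert hxy)) hc)
    · intro x hx
      exact iff_of_true (exists_minorVal_eq_of_mem (hYX hx) (Set.notMem_empty _))
        (exists_minorVal_eq_of_mem (hE _ (hYX hx)).1 (Set.notMem_empty _))
  have hval : ∀ a, Nat.card {h' // h' ∉ P.minorVal ∅ X ⁻¹' Y ∧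
      (P.minor ∅ X).conn (P.minorVal ∅ X ⁻¹' Y) a h'} =
      Nat.card {h' // h' ∉ Y ∧ P.conn Y (P.minorVal ∅ X a) h'} := fun a =>
    card_minor_valence (fun h' _ h => hC ⟨a, rfl⟩ h) (fun b => hconn hYX)
  constructor
  · intro h
    have hYE : P.IsEdgeSet Y := (isEdgeSet_minor_iff hE h0 hs hYX).1 h.edges
    -- at the remaining places, `Y` and `X` agree
    have hagree : ∀ a, P.IsActive Y a → (¬ ∃ x ∈ X, x ∉ Y ∧ P.conn Y a x) →
        P.IsActive X a ∧ ∀ b, P.conn Y a b → (b ∈ X ↔ b ∈ Y) := by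
      intro a hact hn
      have h1 : ∀ b, P.conn Y a b → (b ∈ X ↔ b ∈ Y) := fun b hb =>
        ⟨fun hbX => by_contra fun hbY => hn ⟨b, hbX, hbY, hb⟩, fun hbY => hYX hbY⟩
      obtain ⟨x, hx, hxY, hc⟩ := hact
      exact ⟨⟨x, hx, fun hxX => hxY ((h1 x hc).1 hxX), conn_mono hYX hc⟩, h1⟩
    -- Without an edge of `X \ Y` at it, the `Y`-component of `a` is closed under `X`, so it is
    -- already a component of `X`.
    have hagree' : ∀ a, (¬ ∃ x ∈ X, x ∉ Y ∧ P.conn Y a x) → ∀ b, P.conn X a b → P.conn Y a b := by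
      intro a hn b hab
      have hiff : ∀ x ∈ X, P.conn Y a x → x ∈ Y :=
        fun x hx hc => by_contra fun hxY => hn ⟨x, hx, hxY, hc⟩
      refine conn_le_on (C := {b | P.conn Y a b})
        (fun x y hxy hx => Setoid.trans' _ hx (conn_of_vert hxy)) ?_ (fun _ _ => conn_of_vert) ?_
        (Setoid.refl' (P.conn Y) a) hab
      · intro x hx
        constructor
        · exact fun hc => Setoid.trans' _ hc (conn_flip (hiff x hx hc))
        · intro hc
          have := hiff _ (hE x hx).1 hc
          exact Setoid.trans' _ hc (Setoid.symm' _ (conn_flip (hYE.flip_mem_iff.1 this)))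
      · exact fun x hx hc => conn_flip (hiff x hx hc)
    intro a
    refine ⟨fun ha => (hYE a ha).1, fun ha => (hYE a ha).2, fun ha => ?_, fun hact b hab => ?_,
      fun hact => ?_⟩
    · obtain ⟨c, rfl⟩ := exists_minorVal_eq_of_mem (Y := ∅) (hYX ha) (Set.notMem_empty _)
      exact (minor_bridgeless_iff hE h0 hs hYX ha).1 ((h c).bridgeless ha)
    -- Activity in `P` may come from an edge outside `X`, which the subgraph does not see. If an
    -- edge of `X \ Y` is reached, `a` is active in the subgraph and the hypothesis there applies;
    -- otherwise `X` and `Y` agree near `a`, and admissibility of `X` takes over.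
    · by_cases hn : ∃ x ∈ X, x ∉ Y ∧ P.conn Y a x
      · obtain ⟨x, hx, hxY, hc⟩ := hn
        have hxr := exists_minorVal_eq_of_mem (P := P) (Y := ∅) hx (Set.notMem_empty _)
        obtain ⟨a, rfl⟩ := hC hxr (Setoid.symm' _ hc)
        obtain ⟨b, rfl⟩ := hC ⟨a, rfl⟩ hab
        have := (h a).spans ((isActive_minor_iff hE h0 hs hYX).2 ⟨x, hx, hxY, hc⟩) b
          ((hconn hYX).2 hab)
        rwa [hF, hconn hFX] at this
      · obtain ⟨hactX, hiff⟩ := hagree a hact hn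
        refine conn_le_on (C := {b | P.conn Y a b}) (X := P.F ∩ X)
          (fun x y hxy hx => Setoid.trans' _ hx (conn_of_vert hxy)) ?_ (fun _ _ => conn_of_vert) ?_
          (Setoid.refl' (P.conn Y) a) ((hX a).spans hactX b (conn_mono hYX hab))
        · intro x hx
          constructor
          · exact fun hc => Setoid.trans' _ hc (conn_flip ((hiff x hc).1 hx.2))
          · intro hc
            have := (hiff _ hc).1 (hE x hx.2).1
            exact Setoid.trans' _ hc (Setoid.symm' _ (conn_flip (hYE.flip_mem_iff.1 this)))
        · exact fun x hx hc => conn_flip ⟨hx.1, (hiff x hc).1 hx.2⟩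
    · by_cases hn : ∃ x ∈ X, x ∉ Y ∧ P.conn Y a x
      · obtain ⟨x, hx, hxY, hc⟩ := hn
        have hxr := exists_minorVal_eq_of_mem (P := P) (Y := ∅) hx (Set.notMem_empty _)
        obtain ⟨a, rfl⟩ := hC hxr (Setoid.symm' _ hc)
        rw [← hval]
        exact (h a).valence ((isActive_minor_iff hE h0 hs hYX).2 ⟨x, hx, hxY, hc⟩)
      · obtain ⟨hactX, hiff⟩ := hagree a hact hn
        refine ((hX a).valence hactX).trans_eq
          (Nat.card_congr (Equiv.subtypeEquivRight fun b => ?_))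
        constructor
        · exact fun hb => ⟨fun hbY => hb.1 (hYX hbY), hagree' a hn b hb.2⟩
        · exact fun hb => ⟨fun hbX => hb.1 ((hiff b hb.2).1 hbX), conn_mono hYX hb.2⟩
  · intro h
    have hR := (isEdgeSet_minor_iff hE h0 hs hYX).2 h.edges
    have hact : ∀ a, (P.minor ∅ X).IsActive (P.minorVal ∅ X ⁻¹' Y) a →
        P.IsActive Y (P.minorVal ∅ X a) := fun a ha =>
      let ⟨x, hx, hxY, hc⟩ := (isActive_minor_iff hE h0 hs hYX).1 ha
      ⟨x, hE.subset_internal hx, hxY, hc⟩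
    intro a
    refine ⟨fun ha => (hR a ha).1, fun ha => (hR a ha).2, fun ha => ?_, fun ha b hab => ?_,
      fun ha => ?_⟩
    · exact (minor_bridgeless_iff hE h0 hs hYX ha).2 ((h _).bridgeless ha)
    · rw [hF, hconn hFX]
      exact (h _).spans (hact a ha) _ ((hconn hYX).1 hab)
    · rw [hval]
      exact (h _).valence (hact a ha)

/-- Admissible sets of edges of a quotient. -/
theorem admissible_quot_iff (hY : Admissible k P Y) (hYX : Y ⊆ X) (hXI : X ⊆ P.internal) :
    Admissible k (P.minor Y P.internal) (P.minorVal Y P.internal ⁻¹' X) ↔ Admissible k P X := by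
  have hE := hY.edges
  have hI : P.IsEdgeSet P.internal := isEdgeSet_internal
  have hconn : ∀ {a b}, (P.minor Y P.internal).conn (P.minorVal Y P.internal ⁻¹' X) a b ↔
      P.conn X (P.minorVal Y P.internal a) (P.minorVal Y P.internal b) :=
    minor_conn hI hE hYX hXI
  -- As before, `Y` is added for free in order to apply `minor_conn`; `hspan` below removes it
  -- again.
  have hF : (P.minor Y P.internal).F ∩ P.minorVal Y P.internal ⁻¹' X =
      P.minorVal Y P.internal ⁻¹' (Y ∪ P.F ∩ X) := by
    ext a
    simp only [Set.mem_inter_iff, mem_minor_F, Set.mem_preimage, Set.mem_union]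
    exact ⟨fun h => Or.inr ⟨h.1.1, h.2⟩, fun h =>
      let h' := h.resolve_left (minorVal_notMem a)
      ⟨⟨h'.1, hXI h'.2⟩, h'.2⟩⟩
  have hFX : Y ∪ P.F ∩ X ⊆ P.internal :=
    Set.union_subset hE.subset_internal (Set.inter_subset_right.trans hXI)
  have hact : ∀ {a}, (P.minor Y P.internal).IsActive (P.minorVal Y P.internal ⁻¹' X) a ↔
        P.IsActive X (P.minorVal Y P.internal a) := isActive_minor_iff hI hE hYX hXI
  -- No half-edge is lost for the valence count: activity with respect to `X` implies activity with
  -- respect to the smaller set `Y`, so the contracted vertex is present in the minor.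
  have hbr : (P.IsEdgeSet X → ∀ {a h'}, P.IsActive X a → h' ∉ X →
      P.conn X a h' → ∃ b, P.minorVal Y P.internal b = h') := by
    intro hX a h' ha h1 h2
    obtain ⟨x, hx, hxY, hc⟩ := (ha.conn h2).anti hE hYX hX
    exact exists_minorVal_eq (fun h => h1 (hYX h)) hx hxY hc
  have hval : P.IsEdgeSet X → ∀ a, P.IsActive X (P.minorVal Y P.internal a) →
      Nat.card {h' // h' ∉ P.minorVal Y P.internal ⁻¹' X ∧
      (P.minor Y P.internal).conn (P.minorVal Y P.internal ⁻¹' X) a h'} =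
      Nat.card {h' // h' ∉ X ∧ P.conn X (P.minorVal Y P.internal a) h'} := fun hX a ha =>
    card_minor_valence (fun h' h1 h2 => hbr hX ha h1 h2) (fun b => hconn)
  -- replacing paths through `Y` by paths in the forest
  have hspan : ∀ {a b}, P.IsActive Y a → P.conn (Y ∪ P.F ∩ X) a b → P.conn (P.F ∩ X) a b := by
    intro a b ha hab
    refine conn_le_on (C := {a | P.IsActive Y a}) (fun a b hab ha => ha.conn (conn_of_vert hab))
      (fun x hx => isActive_flip_iff hE (hFX hx)) (fun _ _ => conn_of_vert) ?_ ha hab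
    rintro x (hx | hx) hxa
    · exact conn_mono (Set.inter_subset_inter_right _ hYX) ((hY x).spans hxa _ (conn_flip hx))
    · exact conn_flip hx
  constructor
  · intro h
    have hXE : P.IsEdgeSet X := (isEdgeSet_minor_iff hI hE hYX hXI).1 h.edges
    -- A half-edge in `Y` is missing from the quotient. It is moved along the forest inside its
    -- `Y`-component to a half-edge that survives, which changes neither the spanning nor the
    -- valence condition.
    have hrep : ∀ a, P.IsActive X a → ∃ c, P.conn (P.F ∩ X) a (P.minorVal Y P.internal c) := by
      intro a ha
      have ha' := ha.anti hE hYX hXE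
      obtain ⟨x, hx, hxY, hc⟩ := id ha'
      obtain ⟨c, rfl⟩ := exists_minorVal_eq_of_mem hx hxY
      exact ⟨c, conn_mono (Set.inter_subset_inter_right _ hYX) ((hY a).spans ha' _ hc)⟩
    have hFX' : P.F ∩ X ⊆ X := Set.inter_subset_right
    intro a
    refine ⟨fun ha => (hXE a ha).1, fun ha => (hXE a ha).2, fun ha => ?_, fun ha b hab => ?_,
      fun ha => ?_⟩
    · by_cases haY : a ∈ Y
      · exact conn_mono (Set.sdiff_subset_sdiff_left hYX) ((hY a).bridgeless haY)
      · obtain ⟨c, rfl⟩ := exists_minorVal_eq_of_mem (hXI ha) haY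
        exact (minor_bridgeless_iff hI hE hYX hXI ha).1 ((h c).bridgeless ha)
    · obtain ⟨c, hc⟩ := hrep a ha
      obtain ⟨d, hd⟩ := hrep b (ha.conn hab)
      have hac := conn_mono hFX' hc
      have hcd : P.conn X (P.minorVal Y P.internal c) (P.minorVal Y P.internal d) :=
        Setoid.trans' _ (Setoid.symm' _ hac) (Setoid.trans' _ hab (conn_mono hFX' hd))
      have := (h c).spans (hact.2 (ha.conn hac)) d (hconn.2 hcd)
      rw [hF, minor_conn hI hE Set.subset_union_left hFX] at this
      exact Setoid.trans' _ hc (Setoid.trans' _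
        (hspan ((ha.conn hac).anti hE hYX hXE) this) (Setoid.symm' _ hd))
    · obtain ⟨c, hc⟩ := hrep a ha
      have hac := conn_mono hFX' hc
      have := (h c).valence (hact.2 (ha.conn hac))
      rw [hval hXE c (ha.conn hac)] at this
      refine this.trans_eq (Nat.card_congr (Equiv.subtypeEquivRight fun b => ?_))
      exact and_congr_right fun _ => ⟨fun hb => Setoid.trans' _ hac hb,
        fun hb => Setoid.trans' _ (Setoid.symm' _ hac) hb⟩
  · intro h
    have hR := (isEdgeSet_minor_iff hI hE hYX hXI).2 h.edges
    intro a
    refine ⟨fun ha => (hR a ha).1, fun ha => (hR a ha).2, fun ha => ?_, fun ha b hab => ?_,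
      fun ha => ?_⟩
    · exact (minor_bridgeless_iff hI hE hYX hXI ha).2 ((h _).bridgeless ha)
    · rw [hF, minor_conn hI hE Set.subset_union_left hFX]
      exact conn_mono Set.subset_union_right ((h _).spans (hact.1 ha) _ (hconn.1 hab))
    · rw [hval h.edges a (hact.1 ha)]
      exact (h _).valence (hact.1 ha)

end IsCorePair

/-! ### Unions of components: isomorphisms and disjoint unions -/

variable {Q : MarkedGraph}

/-- The inclusion of a union of connected components. -/
structure IsComponentMap (P Q : MarkedGraph) (f : P.H → Q.H) : Prop where
  injective : Function.Injective f
  vert_iff : ∀ a b, Q.vert (f a) (f b) ↔ P.vert a b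
  map_flip : ∀ a, f (P.flip a) = Q.flip (f a)
  mem_F_iff : ∀ a, f a ∈ Q.F ↔ a ∈ P.F
  mem_range : ∀ a c, Q.vert (f a) c → c ∈ Set.range f

theorem Iso.isComponentMap (e : Iso P Q) : IsComponentMap P Q e.toEquiv where
  injective := e.toEquiv.injective
  vert_iff := e.vert_iff
  map_flip := e.map_flip
  mem_F_iff := e.mem_F_iff
  mem_range _ c _ := e.toEquiv.surjective c

theorem isComponentMap_inl (P Q : MarkedGraph) :
    IsComponentMap P (P.disjUnion Q) Sum.inl where
  injective := Sum.inl_injective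
  vert_iff _ _ := Sum.liftRel_inl_inl
  map_flip _ := rfl
  mem_F_iff _ := Iff.rfl
  mem_range := by
    rintro a (c | c) h
    · exact ⟨c, rfl⟩
    · exact (Sum.not_liftRel_inl_inr h).elim

theorem isComponentMap_inr (P Q : MarkedGraph) :
    IsComponentMap Q (P.disjUnion Q) Sum.inr where
  injective := Sum.inr_injective
  vert_iff _ _ := Sum.liftRel_inr_inr
  map_flip _ := rfl
  mem_F_iff _ := Iff.rfl
  mem_range := by
    rintro a (c | c) h
    · exact (Sum.not_liftRel_inr_inl h).elim
    · exact ⟨c, rfl⟩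

namespace IsComponentMap

variable {f : P.H → Q.H} {X Y : Set Q.H}

theorem flip_mem_range_iff (hf : IsComponentMap P Q f) (x : Q.H) :
    x ∈ Set.range f ↔ Q.flip x ∈ Set.range f := by
  constructor
  · rintro ⟨a, rfl⟩
    exact ⟨P.flip a, hf.map_flip a⟩
  · rintro ⟨a, ha⟩
    exact ⟨P.flip a, by rw [hf.map_flip, ha, Q.flip_flip]⟩

theorem vert_mem_range (hf : IsComponentMap P Q f) (a b : Q.H) (h : Q.vert a b)
    (ha : a ∈ Set.range f) : b ∈ Set.range f := by
  obtain ⟨c, rfl⟩ := ha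
  exact hf.mem_range c b h

theorem conn_mem_range (hf : IsComponentMap P Q f) {a : P.H} {c : Q.H}
    (h : Q.conn X (f a) c) : c ∈ Set.range f :=
  conn_mem hf.vert_mem_range (fun x _ => hf.flip_mem_range_iff x) h ⟨a, rfl⟩

/-- The range of `f` is closed under vertices and flips, so a path that starts there uses only edges
coming from `P`. -/
theorem conn_iff (hf : IsComponentMap P Q f) {a b : P.H} :
    Q.conn X (f a) (f b) ↔ P.conn (f ⁻¹' X) a b := by
  rw [conn_iff_of_vert (R := P.toFeynmanGraph) f (Y := ∅)
    (fun a b => by rw [conn_empty, hf.vert_iff]) (fun a _ => hf.map_flip a), Set.empty_union]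
  constructor
  · intro h
    refine conn_le_on hf.vert_mem_range (fun x _ => hf.flip_mem_range_iff x)
      (fun _ _ => conn_of_vert) ?_ ⟨a, rfl⟩ h
    rintro _ hx ⟨c, rfl⟩
    exact conn_flip ⟨c, hx, rfl⟩
  · exact conn_mono (Set.image_preimage_subset f X)

theorem preimage_internal (hf : IsComponentMap P Q f) : f ⁻¹' Q.internal = P.internal := by
  ext a
  change Q.flip (f a) ≠ f a ↔ P.flip a ≠ a
  rw [← hf.map_flip, hf.injective.ne_iff]

theorem isEdgeSet_preimage (hf : IsComponentMap P Q f) (hX : Q.IsEdgeSet X) :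
    P.IsEdgeSet (f ⁻¹' X) := by
  intro a ha
  have := hX _ ha
  rw [← hf.map_flip, hf.injective.ne_iff] at this
  exact this

theorem preimage_diff_edge (hf : IsComponentMap P Q f) (a : P.H) :
    f ⁻¹' (X \ {f a, Q.flip (f a)}) = f ⁻¹' X \ {a, P.flip a} := by
  ext b
  simp [← hf.map_flip, hf.injective.eq_iff]

theorem conn_flip_iff (hf : IsComponentMap P Q f) {a : P.H} :
    Q.conn (X \ {f a, Q.flip (f a)}) (f a) (Q.flip (f a)) ↔
      P.conn (f ⁻¹' X \ {a, P.flip a}) a (P.flip a) := by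
  rw [← hf.preimage_diff_edge, ← hf.conn_iff, hf.map_flip]

theorem isActive_iff (hf : IsComponentMap P Q f) {a : P.H} :
    Q.IsActive X (f a) ↔ P.IsActive (f ⁻¹' X) a := by
  unfold IsActive
  rw [← hf.preimage_internal]
  constructor
  · rintro ⟨x, hx, hxX, hc⟩
    obtain ⟨b, rfl⟩ := hf.conn_mem_range hc
    exact ⟨b, hx, hxX, hf.conn_iff.1 hc⟩
  · rintro ⟨x, hx, hxX, hc⟩
    exact ⟨f x, hx, hxX, hf.conn_iff.2 hc⟩

theorem card_eq (hf : IsComponentMap P Q f) (p : P.H → Prop) (q : Q.H → Prop)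
    (h : ∀ a, q (f a) ↔ p a) (hq : ∀ b, q b → b ∈ Set.range f) :
    Nat.card {b // q b} = Nat.card {a // p a} := by
  refine (Nat.card_congr (Equiv.ofBijective (fun a => ⟨f a.1, (h _).2 a.2⟩) ⟨?_, ?_⟩)).symm
  · intro a b hab
    exact Subtype.ext (hf.injective (congrArg (fun x => x.1) hab))
  · rintro ⟨b, hb⟩
    obtain ⟨a, rfl⟩ := hq b hb
    exact ⟨⟨a, (h a).1 hb⟩, rfl⟩

/-- Every clause of `AdmissibleAt` concerns only the connected component of the half-edge. This
locality gives both invariance under isomorphism and compatibility with disjoint unions, since there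
the maps in question cover all half-edges. -/
theorem admissibleAt_iff (hf : IsComponentMap P Q f) {a : P.H} :
    AdmissibleAt k Q X (f a) ↔ AdmissibleAt k P (f ⁻¹' X) a := by
  have hF : f ⁻¹' (Q.F ∩ X) = P.F ∩ f ⁻¹' X := by
    ext a
    simp [hf.mem_F_iff]
  have hval : Nat.card {h' // h' ∉ X ∧ Q.conn X (f a) h'} =
      Nat.card {h' // h' ∉ f ⁻¹' X ∧ P.conn (f ⁻¹' X) a h'} :=
    hf.card_eq _ _ (fun b => and_congr Iff.rfl hf.conn_iff) (fun b hb => hf.conn_mem_range hb.2)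
  constructor
  · intro h
    refine ⟨fun ha => ?_, fun ha hn => ?_, fun ha => hf.conn_flip_iff.1 (h.bridgeless ha),
      fun ha b hb => ?_, fun ha => ?_⟩
    · change f (P.flip a) ∈ X
      rw [hf.map_flip]
      exact h.flip_mem ha
    · exact h.flip_ne ha (by rw [← hf.map_flip, hn])
    · rw [← hF, ← hf.conn_iff]
      exact h.spans (hf.isActive_iff.2 ha) _ (hf.conn_iff.2 hb)
    · rw [← hval]
      exact h.valence (hf.isActive_iff.2 ha)
  · intro h
    refine ⟨fun ha => ?_, fun ha hn => ?_, fun ha => hf.conn_flip_iff.2 (h.bridgeless ha),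
      fun ha b hb => ?_, fun ha => ?_⟩
    · rw [← hf.map_flip]
      exact h.flip_mem ha
    · exact h.flip_ne ha (hf.injective (by rw [hf.map_flip, hn]))
    · obtain ⟨b, rfl⟩ := hf.conn_mem_range hb
      rw [hf.conn_iff, hF]
      exact h.spans (hf.isActive_iff.1 ha) _ (hf.conn_iff.1 hb)
    · rw [hval]
      exact h.valence (hf.isActive_iff.1 ha)

theorem exists_minorVal_iff (hf : IsComponentMap P Q f) {a : P.H} :
    (∃ b, Q.minorVal Y X b = f a) ↔ ∃ b, P.minorVal (f ⁻¹' Y) (f ⁻¹' X) b = a := by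
  constructor
  · rintro ⟨b, hb⟩
    obtain ⟨x, hx, hxY, hc⟩ := exists_conn_minorVal b
    rw [hb] at hc
    obtain ⟨x, rfl⟩ := hf.conn_mem_range hc
    exact exists_minorVal_eq (fun h => minorVal_notMem b (hb ▸ h)) hx hxY (hf.conn_iff.1 hc)
  · rintro ⟨b, rfl⟩
    obtain ⟨x, hx, hxY, hc⟩ := exists_conn_minorVal b
    exact exists_minorVal_eq (minorVal_notMem b) hx hxY (hf.conn_iff.2 hc)

theorem minor_flip_eq (hf : IsComponentMap P Q f) (hX : Q.IsEdgeSet X) (hY : Q.IsEdgeSet Y)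
    {a : (P.minor (f ⁻¹' Y) (f ⁻¹' X)).H} {b : (Q.minor Y X).H}
    (hab : Q.minorVal Y X b = f (P.minorVal _ _ a)) :
    Q.minorVal Y X ((Q.minor Y X).flip b) =
      f (P.minorVal _ _ ((P.minor (f ⁻¹' Y) (f ⁻¹' X)).flip a)) := by
  by_cases h : f (P.minorVal _ _ a) ∈ X
  · rw [minorVal_flip hX hY (hab ▸ h),
      minorVal_flip (hf.isEdgeSet_preimage hX) (hf.isEdgeSet_preimage hY) h, hab, hf.map_flip]
  · rw [minor_flip_of_notMem (hab ▸ h), minor_flip_of_notMem h, hab]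

theorem mem_minor_F_iff (hf : IsComponentMap P Q f)
    {a : (P.minor (f ⁻¹' Y) (f ⁻¹' X)).H} {b : (Q.minor Y X).H}
    (hab : Q.minorVal Y X b = f (P.minorVal _ _ a)) :
    b ∈ (Q.minor Y X).F ↔ a ∈ (P.minor (f ⁻¹' Y) (f ⁻¹' X)).F := by
  rw [mem_minor_F, mem_minor_F, hab, Set.mem_inter_iff, hf.mem_F_iff]
  rfl

end IsComponentMap

theorem Iso.symm (e : Iso P Q) : Nonempty (Iso Q P) :=
  ⟨⟨e.toEquiv.symm, fun a b => by simp [← e.vert_iff],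
    fun a => by rw [Equiv.symm_apply_eq, e.map_flip, Equiv.apply_symm_apply],
    fun a => by simp [← e.mem_F_iff]⟩⟩

theorem Iso.isCorePair (e : Iso P Q) (hP : IsCorePair k P) : IsCorePair k Q := by
  have hf := e.isComponentMap
  have hs := e.toEquiv.surjective
  refine ⟨fun h => ?_, fun h => ?_, fun h => ?_, fun h => ?_, fun h => ?_⟩ <;>
    obtain ⟨a, rfl⟩ := hs h
  · intro ha
    rw [hf.conn_flip_iff, hf.preimage_internal]
    exact hP.bridgeless a (by rwa [← hf.preimage_internal])
  · obtain ⟨x, hx, hv⟩ := hP.no_isolated a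
    rw [← hf.preimage_internal] at hx
    exact ⟨_, hx, (e.vert_iff _ _).2 hv⟩
  · rw [hf.card_eq (fun b => P.vert a b) _ (fun b => e.vert_iff a b) (fun b _ => hs b)]
    exact hP.valence a
  · intro ha
    have := hP.edges a ((e.mem_F_iff a).1 ha)
    rw [← e.map_flip, e.mem_F_iff, e.toEquiv.injective.ne_iff]
    exact this
  · intro ha hc
    have hF : e.toEquiv ⁻¹' Q.F = P.F := by
      ext a
      exact e.mem_F_iff a
    rw [hf.conn_flip_iff, hF] at hc
    exact hP.acyclic a ((e.mem_F_iff a).1 ha) hc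

theorem Iso.admissible_iff (e : Iso P Q) {X : Set Q.H} :
    Admissible k P (e.toEquiv ⁻¹' X) ↔ Admissible k Q X := by
  constructor
  · intro h b
    obtain ⟨a, rfl⟩ := e.toEquiv.surjective b
    exact e.isComponentMap.admissibleAt_iff.2 (h a)
  · exact fun h a => e.isComponentMap.admissibleAt_iff.1 (h _)

theorem Iso.nonempty_iso_minor (e : Iso P Q) {X Y : Set Q.H} (hX : Q.IsEdgeSet X)
    (hY : Q.IsEdgeSet Y) :
    Nonempty (Iso (P.minor (e.toEquiv ⁻¹' Y) (e.toEquiv ⁻¹' X)) (Q.minor Y X)) := by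
  have hf := e.isComponentMap
  refine nonempty_iso_of_maps (fun a => e.toEquiv (P.minorVal _ _ a)) (Q.minorVal Y X)
    (e.toEquiv.injective.comp minorVal_injective) minorVal_injective
    (fun a => hf.exists_minorVal_iff.2 ⟨a, rfl⟩) ?_ ?_
    (fun _ _ => hf.minor_flip_eq hX hY) (fun _ _ => hf.mem_minor_F_iff)
  · intro b
    obtain ⟨a, ha⟩ := e.toEquiv.surjective (Q.minorVal Y X b)
    obtain ⟨c, rfl⟩ := hf.exists_minorVal_iff.1 ⟨b, ha.symm⟩
    exact ⟨c, ha⟩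
  · intro a b a' b' ha hb
    rw [minor_vert, minor_vert, ha, hb, hf.conn_iff]

theorem admissible_disjUnion_iff {X : Set (P.disjUnion Q).H} :
    Admissible k (P.disjUnion Q) X ↔
      Admissible k P ((Sum.inl : P.H → (P.disjUnion Q).H) ⁻¹' X) ∧
        Admissible k Q ((Sum.inr : Q.H → (P.disjUnion Q).H) ⁻¹' X) := by
  constructor
  · exact fun h => ⟨fun a => (isComponentMap_inl P Q).admissibleAt_iff.1 (h _),
      fun a => (isComponentMap_inr P Q).admissibleAt_iff.1 (h _)⟩
  · rintro ⟨h1, h2⟩ (a | a)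
    · exact (isComponentMap_inl P Q).admissibleAt_iff.2 (h1 a)
    · exact (isComponentMap_inr P Q).admissibleAt_iff.2 (h2 a)

theorem nonempty_iso_minor_disjUnion {X Y : Set (P.disjUnion Q).H}
    (hX : (P.disjUnion Q).IsEdgeSet X) (hY : (P.disjUnion Q).IsEdgeSet Y) :
    Nonempty (Iso
      ((P.minor ((Sum.inl : P.H → (P.disjUnion Q).H) ⁻¹' Y)
          ((Sum.inl : P.H → (P.disjUnion Q).H) ⁻¹' X)).disjUnion
        (Q.minor ((Sum.inr : Q.H → (P.disjUnion Q).H) ⁻¹' Y)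
          ((Sum.inr : Q.H → (P.disjUnion Q).H) ⁻¹' X)))
      ((P.disjUnion Q).minor Y X)) := by
  have hl := isComponentMap_inl P Q
  have hr := isComponentMap_inr P Q
  refine nonempty_iso_of_maps
    (Sum.elim (fun a => (Sum.inl (P.minorVal _ _ a) : (P.disjUnion Q).H))
      (fun a => (Sum.inr (Q.minorVal _ _ a) : (P.disjUnion Q).H)))
    ((P.disjUnion Q).minorVal Y X) ?_ minorVal_injective ?_ ?_ ?_ ?_ ?_
  · rintro (a | a) (b | b) hab
    · exact congrArg Sum.inl (minorVal_injective (Sum.inl_injective hab))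
    · exact (Sum.inl_ne_inr hab).elim
    · exact (Sum.inr_ne_inl hab).elim
    · exact congrArg Sum.inr (minorVal_injective (Sum.inr_injective hab))
  · rintro (a | a)
    · exact hl.exists_minorVal_iff.2 ⟨a, rfl⟩
    · exact hr.exists_minorVal_iff.2 ⟨a, rfl⟩
  · intro b
    rcases hb : (P.disjUnion Q).minorVal Y X b with a | a
    · obtain ⟨c, rfl⟩ := hl.exists_minorVal_iff.1 ⟨b, hb⟩
      exact ⟨Sum.inl c, rfl⟩
    · obtain ⟨c, rfl⟩ := hr.exists_minorVal_iff.1 ⟨b, hb⟩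
      exact ⟨Sum.inr c, rfl⟩
  · rintro (a | a) (b | b) a' b' ha hb
    · rw [minor_vert, ha, hb]
      exact hl.conn_iff.trans ((isComponentMap_inl (P.minor _ _) (Q.minor _ _)).vert_iff a b).symm
    · rw [minor_vert, ha, hb]
      refine iff_of_false (fun h => ?_) Sum.not_liftRel_inl_inr
      obtain ⟨c, hc⟩ := hl.conn_mem_range h
      exact Sum.inl_ne_inr hc
    · rw [minor_vert, ha, hb]
      refine iff_of_false (fun h => ?_) Sum.not_liftRel_inr_inl
      obtain ⟨c, hc⟩ := hr.conn_mem_range h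
      exact Sum.inr_ne_inl hc
    · rw [minor_vert, ha, hb]
      exact hr.conn_iff.trans ((isComponentMap_inr (P.minor _ _) (Q.minor _ _)).vert_iff a b).symm
  · rintro (a | a) a' ha
    · exact hl.minor_flip_eq hX hY ha
    · exact hr.minor_flip_eq hX hY ha
  · rintro (a | a) a' ha
    · exact hl.mem_minor_F_iff ha
    · exact hr.mem_minor_F_iff ha

end MarkedGraph

/-! ### Loop numbers -/

theorem Setoid.card_quotient_comap {α β : Type*} (r : Setoid α) (f : β → α)
    (hcov : ∀ a, ∃ b, r (f b) a) : Nat.card (Quotient (r.comap f)) = Nat.card (Quotient r) := by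
  refine Nat.card_congr (Equiv.ofBijective
    (Quotient.map' f (fun _ _ h => h) : Quotient (r.comap f) → Quotient r) ⟨?_, ?_⟩)
  · rintro ⟨a⟩ ⟨b⟩ h
    have h' : r (f a) (f b) := Quotient.exact h
    exact Quotient.sound (s := r.comap f) h'
  · rintro ⟨a⟩
    obtain ⟨b, hb⟩ := hcov a
    exact ⟨Quotient.mk _ b, Quotient.sound hb⟩

/-- `f` and `g` meet disjoint families of classes that together exhaust the quotient. -/
theorem Setoid.card_quotient_eq_add {α β γ : Type*} [Finite α] (r : Setoid α) (f : β → α)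
    (g : γ → α) (hfg : ∀ b c, ¬ r (f b) (g c))
    (hcov : ∀ a, (∃ b, r (f b) a) ∨ ∃ c, r (g c) a) :
    Nat.card (Quotient r) =
      Nat.card (Quotient (r.comap f)) + Nat.card (Quotient (r.comap g)) := by
  let u : Quotient (r.comap f) → Quotient r := Quotient.map' f (fun _ _ h => h)
  let v : Quotient (r.comap g) → Quotient r := Quotient.map' g (fun _ _ h => h)
  have hu : Function.Injective u := by
    rintro ⟨a⟩ ⟨b⟩ h
    have h' : r (f a) (f b) := Quotient.exact h
    exact Quotient.sound (s := r.comap f) h'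
  have hv : Function.Injective v := by
    rintro ⟨a⟩ ⟨b⟩ h
    have h' : r (g a) (g b) := Quotient.exact h
    exact Quotient.sound (s := r.comap g) h'
  have := Finite.of_injective u hu
  have := Finite.of_injective v hv
  rw [← Nat.card_sum]
  refine (Nat.card_congr (Equiv.ofBijective (Sum.elim u v) ⟨hu.sumElim hv ?_, ?_⟩)).symm
  · rintro ⟨a⟩ ⟨b⟩ h
    exact hfg a b (Quotient.exact h)
  · rintro ⟨a⟩
    rcases hcov a with ⟨b, hb⟩ | ⟨b, hb⟩
    · exact ⟨Sum.inl (Quotient.mk _ b), Quotient.sound hb⟩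
    · exact ⟨Sum.inr (Quotient.mk _ b), Quotient.sound hb⟩

namespace FeynmanGraph

variable {G : FeynmanGraph}

theorem numComponents_empty : G.numComponents ∅ = G.numVertices := by
  have : G.conn ∅ = G.vert := Setoid.ext fun _ _ => conn_empty
  rw [numComponents, this, numVertices]

/-- Putting the edge back can only merge the class of `h` with that of its other end. So the map to
the larger components is injective once the class of `h` is sent to a separate point. -/
theorem numComponents_diff_edge_le (X : Set G.H) (h : G.H) :
    G.numComponents (X \ {h, G.flip h}) ≤ G.numComponents X + 1 := by
  classical
  set Z := X \ {h, G.flip h}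
  let u : Quotient (G.conn Z) → Quotient (G.conn X) :=
    Quotient.map' id (fun _ _ h => conn_mono Set.sdiff_subset h)
  let φ : Quotient (G.conn Z) → Option (Quotient (G.conn X)) := fun q =>
    if q = Quotient.mk _ h then none else some (u q)
  have hφ : Function.Injective φ := by
    rintro ⟨a⟩ ⟨b⟩ hab
    change (if (Quotient.mk (G.conn Z) a) = Quotient.mk _ h then none else some (u _)) =
      (if (Quotient.mk (G.conn Z) b) = Quotient.mk _ h then none else some (u _)) at hab
    split_ifs at hab with h1 h2 h2
    · exact h1.trans h2.symm
    · have hc : G.conn X a b := Quotient.exact (Option.some_injective _ hab)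
      rcases conn_insert_edge (e := h) hc with hc | ⟨hc, -⟩ | ⟨-, hc⟩
      · exact Quotient.sound hc
      · exact absurd (Quotient.sound hc) h1
      · exact absurd (Quotient.sound (Setoid.symm' _ hc)) h2
  have := Nat.card_le_card_of_injective φ hφ
  rwa [Finite.card_option] at this

theorem IsEdgeSet.diff_edge {X : Set G.H} (hX : G.IsEdgeSet X) (h : G.H) :
    G.IsEdgeSet (X \ {h, G.flip h}) := by
  rintro x ⟨hx, hxh⟩
  refine ⟨⟨(hX x hx).1, ?_⟩, (hX x hx).2⟩
  rintro (h' | h')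
  · exact hxh (Or.inr (by rw [← h', Set.mem_singleton_iff, G.flip_flip]))
  · exact hxh (Or.inl (flip_injective h'))

theorem IsEdgeSet.ncard_diff_edge {X : Set G.H} (hX : G.IsEdgeSet X) {h : G.H} (hh : h ∈ X) :
    (X \ {h, G.flip h}).ncard + 2 = X.ncard := by
  rw [← Set.ncard_pair (hX h hh).2.symm]
  refine Set.ncard_sdiff_add_ncard_of_subset ?_
  rintro x (rfl | rfl)
  · exact hh
  · exact (hX h hh).1

/-- A graph with `n` edges has at most `n` vertices more than components. -/
theorem IsEdgeSet.numVertices_le {X : Set G.H} (hX : G.IsEdgeSet X) :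
    ∃ n, X.ncard = 2 * n ∧ G.numVertices ≤ n + G.numComponents X := by
  induction hn : X.ncard using Nat.strong_induction_on generalizing X with
  | _ m ih =>
    rcases X.eq_empty_or_nonempty with rfl | ⟨h, hh⟩
    · refine ⟨0, by simpa using hn.symm, ?_⟩
      rw [numComponents_empty, zero_add]
    · have hcard := hX.ncard_diff_edge hh
      obtain ⟨n, hn1, hn2⟩ := ih _ (by omega) (hX.diff_edge h) rfl
      have := numComponents_diff_edge_le X h
      exact ⟨n + 1, by omega, by omega⟩

/-- The half-edges of an edge set come in pairs, so the division in `numEdges` is exact. -/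
theorem two_mul_numEdges (G : FeynmanGraph) : 2 * G.numEdges = G.internal.ncard := by
  obtain ⟨n, hn, -⟩ := (isEdgeSet_internal (G := G)).numVertices_le
  rw [numEdges, Nat.card_coe_set_eq]
  omega

/-- By `IsEdgeSet.numVertices_le` the subtraction in `loopNumber` does not truncate. -/
theorem loopNumber_add (G : FeynmanGraph) :
    G.loopNumber + G.numVertices = G.numEdges + G.numComponents G.internal := by
  obtain ⟨n, hn, h⟩ := (isEdgeSet_internal (G := G)).numVertices_le
  have := G.two_mul_numEdges
  rw [loopNumber]
  omega

/-- Removing an edge that is not a bridge keeps the components, so the bound on the number of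
vertices holds already with one edge fewer. -/
theorem IsBridgeless.loopNumber_pos (hG : G.IsBridgeless) {h : G.H} (hh : h ∈ G.internal) :
    0 < G.loopNumber := by
  obtain ⟨n, hn, hle⟩ := ((isEdgeSet_internal (G := G)).diff_edge h).numVertices_le
  have h1 := (isEdgeSet_internal (G := G)).ncard_diff_edge hh
  have h2 := G.two_mul_numEdges
  have h3 := G.loopNumber_add
  have h4 : G.conn (G.internal \ {h, G.flip h}) = G.conn G.internal := by
    refine le_antisymm (fun _ _ => conn_mono Set.sdiff_subset) (fun a b hab => ?_)
    refine conn_le (fun _ _ => conn_of_vert) (fun x hx => ?_) hab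
    by_cases hxh : x = h
    · exact hxh ▸ hG h hh
    by_cases hxh' : x = G.flip h
    · rw [hxh', G.flip_flip]
      exact Setoid.symm' _ (hG h hh)
    · exact conn_flip ⟨hx, by simp [hxh, hxh']⟩
  have h5 : G.numComponents (G.internal \ {h, G.flip h}) = G.numComponents G.internal := by
    rw [numComponents, h4, numComponents]
  omega

end FeynmanGraph

namespace MarkedGraph

open FeynmanGraph

variable {P Q : MarkedGraph} {k : ℕ}

theorem ncard_internal_minor {X Y : Set P.H} (hX : P.IsEdgeSet X) (hY : P.IsEdgeSet Y)
    (hYX : Y ⊆ X) : (P.minor Y X).internal.ncard + Y.ncard = X.ncard := by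
  have e : P.minorVal Y X '' (P.minor Y X).internal = X \ Y := by
    rw [internal_minor hX hY]
    ext x
    constructor
    · rintro ⟨a, ha, rfl⟩
      exact ⟨ha, minorVal_notMem a⟩
    · rintro ⟨hx, hxY⟩
      obtain ⟨a, rfl⟩ := exists_minorVal_eq_of_mem hx hxY
      exact ⟨a, hx, rfl⟩
  rw [← Set.ncard_image_of_injective _ minorVal_injective, e]
  exact Set.ncard_sdiff_add_ncard_of_subset hYX

/-- Let `C` be the union of the `Y`-components met by `X \ Y`. Inside `C`, the `Y`-components are
the vertices of the minor and the `X`-components are its connected components. Outside `C` the two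
kinds of components coincide, and their number cancels. -/
theorem numVertices_minor_add {X Y : Set P.H} (hX : P.IsEdgeSet X) (hY : P.IsEdgeSet Y)
    (hYX : Y ⊆ X) :
    (P.minor Y X).numVertices + P.numComponents X =
      (P.minor Y X).numComponents (P.minor Y X).internal + P.numComponents Y := by
  set C : Set P.H := {a | ∃ x ∈ X, x ∉ Y ∧ P.conn Y a x} with hC
  have hCv : ∀ a b, P.vert a b → a ∈ C → b ∈ C := by
    rintro a b hab ⟨x, hx, hxY, hc⟩
    exact ⟨x, hx, hxY, Setoid.trans' _ (Setoid.symm' _ (conn_of_vert hab)) hc⟩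
  have hCf : ∀ a ∈ X, (a ∈ C ↔ P.flip a ∈ C) := by
    intro a ha
    by_cases haY : a ∈ Y
    · constructor
      · rintro ⟨x, hx, hxY, hc⟩
        exact ⟨x, hx, hxY, Setoid.trans' _ (Setoid.symm' _ (conn_flip haY)) hc⟩
      · rintro ⟨x, hx, hxY, hc⟩
        exact ⟨x, hx, hxY, Setoid.trans' _ (conn_flip haY) hc⟩
    · exact iff_of_true ⟨a, ha, haY, Setoid.refl' _ _⟩ ⟨_, (hX a ha).1,
        fun h => haY (hY.flip_mem_iff.1 h), Setoid.refl' _ _⟩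
  let f := P.minorVal Y X
  let g : ↥Cᶜ → P.H := Subtype.val
  have hf : ∀ a, f a ∈ C := fun a => exists_conn_minorVal a
  have hcov : ∀ a, (∃ b, P.conn Y (f b) a) ∨ ∃ c, P.conn Y (g c) a := by
    intro a
    by_cases ha : a ∈ C
    · obtain ⟨x, hx, hxY, hc⟩ := ha
      obtain ⟨b, rfl⟩ := exists_minorVal_eq_of_mem hx hxY
      exact Or.inl ⟨b, Setoid.symm' _ hc⟩
    · exact Or.inr ⟨⟨a, ha⟩, Setoid.refl' _ _⟩
  have hfg : ∀ b c, ¬ P.conn X (f b) (g c) := fun b c h => c.2 (conn_mem hCv hCf h (hf b))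
  have e1 := (P.conn Y).card_quotient_eq_add f g (fun b c h => hfg b c (conn_mono hYX h)) hcov
  have e2 := (P.conn X).card_quotient_eq_add f g hfg (fun a => (hcov a).imp
    (fun ⟨b, h⟩ => ⟨b, conn_mono hYX h⟩) (fun ⟨b, h⟩ => ⟨b, conn_mono hYX h⟩))
  have e3 : (P.conn X).comap g = (P.conn Y).comap g := by
    refine Setoid.ext fun a b => ⟨fun h => ?_, fun h => conn_mono hYX h⟩
    exact conn_le_on (C := Cᶜ) (fun x y hxy hx hy => hx (hCv y x (P.vert.symm hxy) hy))
      (fun x hx => not_congr (hCf x hx)) (fun _ _ => conn_of_vert)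
      (fun x hx hxC => conn_flip (by_contra fun hxY => hxC ⟨x, hx, hxY, Setoid.refl' _ _⟩)) a.2 h
  have e4 : (P.minor Y X).conn (P.minor Y X).internal = (P.conn X).comap f := by
    rw [internal_minor hX hY]
    exact Setoid.ext fun a b => minor_conn hX hY hYX subset_rfl
  have e5 : (P.minor Y X).numVertices = Nat.card (Quotient ((P.conn Y).comap f)) := rfl
  rw [e5, numComponents, numComponents, numComponents, e4, e1, e2, e3]
  omega

/-- The loop numbers of a subgraph and of its quotient add up. -/
theorem loopNumber_minor_add {X : Set P.H} (hX : P.IsEdgeSet X) :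
    (P.minor ∅ X).loopNumber + (P.minor X P.internal).loopNumber = P.loopNumber := by
  have h0 : P.IsEdgeSet (∅ : Set P.H) := isEdgeSet_empty
  have hI : P.IsEdgeSet P.internal := isEdgeSet_internal
  have a1 := ncard_internal_minor hX h0 (Set.empty_subset _)
  have a2 := ncard_internal_minor hI hX hX.subset_internal
  -- The number of components of `(P, X)` occurs on opposite sides of `b1` and `b2` and drops out of
  -- their sum.
  have b1 := numVertices_minor_add hX h0 (Set.empty_subset _)
  have b2 := numVertices_minor_add hI hX hX.subset_internal
  have c1 := (P.minor ∅ X).two_mul_numEdges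
  have c2 := (P.minor X P.internal).two_mul_numEdges
  have c := P.two_mul_numEdges
  have d1 := (P.minor ∅ X).loopNumber_add
  have d2 := (P.minor X P.internal).loopNumber_add
  have d := P.loopNumber_add
  rw [numComponents_empty] at b1
  rw [Set.ncard_empty] at a1
  omega

theorem Iso.loopNumber_eq (e : Iso P Q) : P.loopNumber = Q.loopNumber := by
  have hf := e.isComponentMap
  have hc : ∀ X : Set Q.H, P.numComponents (e.toEquiv ⁻¹' X) = Q.numComponents X := by
    intro X
    have : P.conn (e.toEquiv ⁻¹' X) = (Q.conn X).comap e.toEquiv :=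
      Setoid.ext fun a b => hf.conn_iff.symm
    rw [numComponents, this, Setoid.card_quotient_comap, numComponents]
    exact fun a => ⟨e.toEquiv.symm a, by rw [Equiv.apply_symm_apply]⟩
  have h1 := hc ∅
  have h2 := hc Q.internal
  rw [Set.preimage_empty, numComponents_empty, numComponents_empty] at h1
  rw [hf.preimage_internal] at h2
  have h3 : Q.internal.ncard = P.internal.ncard := by
    rw [← Set.ncard_image_of_injective P.internal e.toEquiv.injective, ← hf.preimage_internal,
      Set.image_preimage_eq _ e.toEquiv.surjective]
  have := P.two_mul_numEdges
  have := Q.two_mul_numEdges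
  have := P.loopNumber_add
  have := Q.loopNumber_add
  omega

theorem loopNumber_disjUnion (P Q : MarkedGraph) :
    (P.disjUnion Q).loopNumber = P.loopNumber + Q.loopNumber := by
  have hl := isComponentMap_inl P Q
  have hr := isComponentMap_inr P Q
  have hc : ∀ X : Set (P.disjUnion Q).H, (P.disjUnion Q).numComponents X =
      P.numComponents ((Sum.inl : P.H → (P.disjUnion Q).H) ⁻¹' X) +
        Q.numComponents ((Sum.inr : Q.H → (P.disjUnion Q).H) ⁻¹' X) := by
    intro X
    have e1 : P.conn ((Sum.inl : P.H → (P.disjUnion Q).H) ⁻¹' X) =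
      ((P.disjUnion Q).conn X).comap Sum.inl := Setoid.ext fun a b => hl.conn_iff.symm
    have e2 : Q.conn ((Sum.inr : Q.H → (P.disjUnion Q).H) ⁻¹' X) =
      ((P.disjUnion Q).conn X).comap Sum.inr := Setoid.ext fun a b => hr.conn_iff.symm
    rw [numComponents, numComponents, numComponents, e1, e2]
    refine Setoid.card_quotient_eq_add _ _ _ (fun b c h => ?_) ?_
    · obtain ⟨a, ha⟩ := hl.conn_mem_range h
      exact Sum.inl_ne_inr ha
    · rintro (a | a)
      · exact Or.inl ⟨a, Setoid.refl' _ _⟩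
      · exact Or.inr ⟨a, Setoid.refl' _ _⟩
  have h1 := hc ∅
  have h2 : (P.disjUnion Q).numComponents (P.disjUnion Q).internal =
      P.numComponents P.internal + Q.numComponents Q.internal := by
    rw [← hl.preimage_internal, ← hr.preimage_internal]
    exact hc _
  change (P.disjUnion Q).numComponents ∅ = P.numComponents ∅ + Q.numComponents ∅ at h1
  rw [numComponents_empty, numComponents_empty, numComponents_empty] at h1
  have h3 : (P.disjUnion Q).internal.ncard = P.internal.ncard + Q.internal.ncard := by
    rw [← Set.ncard_image_of_injective P.internal hl.injective,
      ← Set.ncard_image_of_injective Q.internal hr.injective, ← Set.ncard_union_eq]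
    · congr 1
      rw [← hl.preimage_internal, ← hr.preimage_internal]
      ext x
      constructor
      · intro hx
        rcases x with x | x
        · exact Or.inl ⟨x, hx, rfl⟩
        · exact Or.inr ⟨x, hx, rfl⟩
      · rintro (⟨a, ha, rfl⟩ | ⟨a, ha, rfl⟩) <;> exact ha
    · rw [Set.disjoint_left]
      rintro _ ⟨a, -, rfl⟩ ⟨b, -, hb⟩
      exact Sum.inr_ne_inl hb
  have := P.two_mul_numEdges
  have := Q.two_mul_numEdges
  have := (P.disjUnion Q).two_mul_numEdges
  have := P.loopNumber_add
  have := Q.loopNumber_add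
  have := (P.disjUnion Q).loopNumber_add
  omega

end MarkedGraph

/-! ### Isomorphism classes and sums over admissible sets -/

open FeynmanGraph MarkedGraph

namespace MarkedGraph

variable {P Q : MarkedGraph} {k : ℕ}

theorem admissible_empty (hP : IsCorePair k P) : Admissible k P ∅ := fun h =>
  ⟨fun h => h.elim, fun h => h.elim, fun h => h.elim,
    fun _ _ hab => conn_mono (Set.empty_subset _) hab, fun _ => hP.card_vert h⟩

/-- Nothing is active when all edges are contracted, so the spanning and valence conditions are
vacuous. This is why the term `(G, F) ⊗ 𝕀` occurs even if `F` is not a spanning tree. -/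
theorem admissible_internal (hP : IsCorePair k P) : Admissible k P P.internal := fun h =>
  have hn : ¬ P.IsActive P.internal h := fun ⟨_, hx, hx', _⟩ => hx' hx
  ⟨fun h => (isEdgeSet_internal _ h).1, fun h => (isEdgeSet_internal _ h).2, hP.bridgeless h,
    fun ha => (hn ha).elim, fun ha => (hn ha).elim⟩

theorem IsCorePair.nonempty_iso_minor_empty_internal (hP : IsCorePair k P) :
    Nonempty (Iso (P.minor ∅ P.internal) P) := by
  refine nonempty_iso_of_maps (P.minorVal _ _) id minorVal_injective Function.injective_id
    (fun a => ⟨_, rfl⟩) ?_ ?_ ?_ ?_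
  · intro b
    obtain ⟨x, hx, hv⟩ := hP.no_isolated b
    exact exists_minorVal_eq (Set.notMem_empty _) hx (Set.notMem_empty _) (conn_of_vert hv)
  · rintro a b _ _ rfl rfl
    exact conn_empty.symm
  · rintro a _ rfl
    change P.flip _ = _
    by_cases ha : P.minorVal ∅ P.internal a ∈ P.internal
    · exact (minorVal_flip isEdgeSet_internal isEdgeSet_empty ha).symm
    · rw [minor_flip_of_notMem ha]
      exact not_not.1 ha
  · rintro a _ rfl
    rw [mem_minor_F]
    exact ⟨fun h => ⟨h, hP.edges.subset_internal h⟩, And.left⟩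

theorem nonempty_iso_of_isEmpty [IsEmpty P.H] [IsEmpty Q.H] : Nonempty (Iso P Q) :=
  ⟨⟨Equiv.equivOfIsEmpty _ _, isEmptyElim, isEmptyElim, isEmptyElim⟩⟩

theorem isCorePair_of_isEmpty [IsEmpty P.H] : IsCorePair k P where
  bridgeless := isEmptyElim
  no_isolated := isEmptyElim
  valence := isEmptyElim
  edges := isEmptyElim
  acyclic := isEmptyElim

open Classical in
/-- The isomorphism class of a pair of a core graph and a spanning forest. -/
noncomputable def gfClass (k : ℕ) (P : MarkedGraph) : GFClass k :=
  -- The default value `1` makes the class a total function, so that minors can be used in sums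
  -- without carrying proofs. Isomorphic pairs have equal values also when it is taken.
  if h : IsCorePair k P then Quotient.mk _ ⟨P, h⟩ else 1

theorem gfClass_eq (hP : IsCorePair k P) : gfClass k P = Quotient.mk _ ⟨P, hP⟩ := dif_pos hP

theorem gfClass_congr (h : Nonempty (Iso P Q)) : gfClass k P = gfClass k Q := by
  obtain ⟨e⟩ := h
  by_cases hP : IsCorePair k P
  · rw [gfClass_eq hP, gfClass_eq (e.isCorePair hP)]
    exact Quotient.sound ⟨e⟩
  · obtain ⟨e'⟩ := e.symm
    have h1 : gfClass k P = 1 := dif_neg hP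
    have h2 : gfClass k Q = 1 := dif_neg fun hQ => hP (e'.isCorePair hQ)
    rw [h1, h2]

theorem gfClass_disjUnion (hP : IsCorePair k P) (hQ : IsCorePair k Q) :
    gfClass k (P.disjUnion Q) = gfClass k P * gfClass k Q := by
  rw [gfClass_eq hP, gfClass_eq hQ, gfClass_eq (isCorePair_disjUnion hP hQ)]
  rfl

theorem gfClass_eq_one_iff (hP : IsCorePair k P) : gfClass k P = 1 ↔ IsEmpty P.H := by
  rw [gfClass_eq hP]
  constructor
  · intro h
    obtain ⟨e⟩ : Nonempty (Iso P empty) := Quotient.exact h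
    exact ⟨fun a => (e.toEquiv a).elim⟩
  · intro h
    have : IsEmpty empty.H := inferInstanceAs (IsEmpty Empty)
    exact Quotient.sound (nonempty_iso_of_isEmpty (P := P) (Q := empty))

theorem isEmpty_minor_iff {X Y : Set P.H} : IsEmpty (P.minor Y X).H ↔ X ⊆ Y := by
  constructor
  · intro h x hx
    by_contra hxY
    exact h.elim (exists_minorVal_eq_of_mem hx hxY).choose
  · exact fun h => ⟨fun a => let ⟨x, hx, hxY, _⟩ := exists_conn_minorVal a; hxY (h hx)⟩

/-- The finite set of admissible sets of edges. -/
noncomputable def admissibleSets (k : ℕ) (P : MarkedGraph) : Finset (Set P.H) :=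
  (Set.toFinite {X | Admissible k P X}).toFinset

theorem mem_admissibleSets {X : Set P.H} : X ∈ admissibleSets k P ↔ Admissible k P X := by
  simp [admissibleSets]

-- The inner sum when the coproduct is applied again to the left factor, pulled back to subsets of
-- `X` in `P`.
open Classical in
theorem sum_admissibleSets_sub {M : Type*} [AddCommMonoid M] {X : Set P.H}
    (hX : Admissible k P X) (f : Set (P.minor ∅ X).H → M) :
    ∑ Z ∈ admissibleSets k (P.minor ∅ X), f Z =
      ∑ Y ∈ admissibleSets k P with Y ⊆ X, f (P.minorVal ∅ X ⁻¹' Y) := by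
  have key : ∀ Z : Set (P.minor ∅ X).H, Admissible k (P.minor ∅ X) Z →
      P.minorVal ∅ X '' Z ⊆ X := by
    rintro Z hZ _ ⟨a, ha, rfl⟩
    have : a ∈ (P.minor ∅ X).internal := hZ.edges.subset_internal ha
    rwa [internal_minor hX.edges isEdgeSet_empty] at this
  refine Finset.sum_nbij' (P.minorVal ∅ X '' ·) (P.minorVal ∅ X ⁻¹' ·) ?_ ?_ ?_ ?_ ?_
  · intro Z hZ
    rw [mem_admissibleSets] at hZ
    rw [Finset.mem_filter, mem_admissibleSets, ← admissible_sub_iff hX (key Z hZ),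
      Set.preimage_image_eq _ minorVal_injective]
    exact ⟨hZ, key Z hZ⟩
  · intro Y hY
    rw [Finset.mem_filter, mem_admissibleSets] at hY
    rw [mem_admissibleSets, admissible_sub_iff hX hY.2]
    exact hY.1
  · exact fun Z _ => Set.preimage_image_eq _ minorVal_injective
  · intro Y hY
    rw [Finset.mem_filter] at hY
    simpa using union_image_minorVal (P := P) (Set.empty_subset Y) hY.2
  · exact fun Z _ => by rw [Set.preimage_image_eq _ minorVal_injective]

-- The inner sum when the coproduct is applied again to the right factor, pulled back to sets of `P`
-- above `Y`.
open Classical in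
theorem sum_admissibleSets_quot {M : Type*} [AddCommMonoid M] {Y : Set P.H}
    (hY : Admissible k P Y) (f : Set (P.minor Y P.internal).H → M) :
    ∑ Z ∈ admissibleSets k (P.minor Y P.internal), f Z =
      ∑ X ∈ admissibleSets k P with Y ⊆ X, f (P.minorVal Y P.internal ⁻¹' X) := by
  have key : ∀ Z : Set (P.minor Y P.internal).H, Admissible k (P.minor Y P.internal) Z →
      Y ∪ P.minorVal Y P.internal '' Z ⊆ P.internal := by
    rintro Z hZ
    refine Set.union_subset hY.edges.subset_internal ?_
    rintro _ ⟨a, ha, rfl⟩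
    have : a ∈ (P.minor Y P.internal).internal := hZ.edges.subset_internal ha
    rwa [internal_minor isEdgeSet_internal hY.edges] at this
  refine Finset.sum_nbij' (fun Z => Y ∪ P.minorVal Y P.internal '' Z)
    (P.minorVal Y P.internal ⁻¹' ·) ?_ ?_ ?_ ?_ ?_
  · intro Z hZ
    rw [mem_admissibleSets] at hZ
    rw [Finset.mem_filter, mem_admissibleSets,
      ← admissible_quot_iff hY Set.subset_union_left (key Z hZ), preimage_union_image_minorVal]
    exact ⟨hZ, Set.subset_union_left⟩
  · intro X hX
    rw [Finset.mem_filter, mem_admissibleSets] at hX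
    rw [mem_admissibleSets, admissible_quot_iff hY hX.2 hX.1.edges.subset_internal]
    exact hX.1
  · exact fun Z _ => preimage_union_image_minorVal Z
  · intro X hX
    rw [Finset.mem_filter, mem_admissibleSets] at hX
    exact union_image_minorVal hX.2 hX.1.edges.subset_internal
  · exact fun Z _ => by rw [preimage_union_image_minorVal]

end MarkedGraph

/-! ### The bialgebra -/

namespace HGF

variable {k : ℕ}

attribute [local instance] HGF.algebra

/-- The basis elements. -/
noncomputable def of (k : ℕ) : GFClass k →* HGF k := MonoidAlgebra.of ℚ (GFClass k)

/-- The basis of isomorphism classes. -/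
noncomputable def basis (k : ℕ) : Module.Basis (GFClass k) ℚ (HGF k) :=
  MonoidAlgebra.basis (GFClass k) ℚ

theorem basis_apply (m : GFClass k) : basis k m = of k m := by
  simp [basis, of]
  rfl

theorem gen_eq (P : CorePair k) : gen P = of k (gfClass k P.1) := by
  rw [gfClass_eq P.2]
  rfl

/-- The algebra map that extends a map of monoids. -/
noncomputable def lift {A : Type*} [Semiring A] [Algebra ℚ A] (φ : GFClass k →* A) :
    HGF k →ₐ[ℚ] A := MonoidAlgebra.lift ℚ A (GFClass k) φ

theorem lift_of {A : Type*} [Semiring A] [Algebra ℚ A] (φ : GFClass k →* A) (m : GFClass k) :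
    lift φ (of k m) = φ m := MonoidAlgebra.lift_of φ m

theorem linearMap_ext {M : Type*} [AddCommMonoid M] [Module ℚ M] {f g : HGF k →ₗ[ℚ] M}
    (h : ∀ P, IsCorePair k P → f (of k (gfClass k P)) = g (of k (gfClass k P))) : f = g := by
  refine (basis k).ext fun m => ?_
  rw [basis_apply]
  obtain ⟨⟨P, hP⟩, rfl⟩ := Quotient.exists_rep m
  have := h P hP
  rwa [gfClass_eq hP] at this

/-- The sum over the admissible sets of edges that defines the coproduct. -/
noncomputable def coproductSum (k : ℕ) (P : MarkedGraph) : HGF k ⊗[ℚ] HGF k :=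
  ∑ X ∈ admissibleSets k P,
    of k (gfClass k (P.minor ∅ X)) ⊗ₜ[ℚ] of k (gfClass k (P.minor X P.internal))

theorem coproductSum_congr {P Q : MarkedGraph} (e : Iso P Q) :
    coproductSum k P = coproductSum k Q := by
  have h1 : ∀ X : Set P.H, e.toEquiv ⁻¹' (e.toEquiv.symm ⁻¹' X) = X := fun X => by
    rw [← Set.preimage_comp]
    simp
  have h2 : ∀ X : Set Q.H, e.toEquiv.symm ⁻¹' (e.toEquiv ⁻¹' X) = X := fun X => by
    rw [← Set.preimage_comp]
    simp
  refine (Finset.sum_nbij' (e.toEquiv ⁻¹' ·) (e.toEquiv.symm ⁻¹' ·) ?_ ?_ ?_ ?_ ?_).symm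
  · intro X hX
    rw [mem_admissibleSets] at hX ⊢
    exact e.admissible_iff.2 hX
  · intro X hX
    rw [mem_admissibleSets] at hX ⊢
    rw [← e.admissible_iff, h1]
    exact hX
  · exact fun X _ => h2 X
  · exact fun X _ => h1 X
  · intro X hX
    rw [mem_admissibleSets] at hX
    have e1 := gfClass_congr (k := k) (e.nonempty_iso_minor hX.edges isEdgeSet_empty)
    have e2 := gfClass_congr (k := k) (e.nonempty_iso_minor isEdgeSet_internal hX.edges)
    rw [e.isComponentMap.preimage_internal] at e2
    rw [Set.preimage_empty] at e1
    rw [e1, e2]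

theorem coproductSum_empty : coproductSum k MarkedGraph.empty = 1 := by
  have h : ∀ X : Set MarkedGraph.empty.H, X = ∅ := fun X =>
    Set.eq_empty_of_forall_notMem fun x => x.elim
  have h0 : ∀ X Y, gfClass k (MarkedGraph.empty.minor Y X) = 1 := fun X Y => by
    have : IsEmpty (MarkedGraph.empty.minor Y X).H :=
      isEmpty_minor_iff.2 (by rw [h X]; exact Set.empty_subset _)
    exact (gfClass_eq_one_iff isCorePair_of_isEmpty).2 this
  rw [coproductSum, Finset.sum_eq_single ∅]
  · rw [h0, h0, map_one]
    rfl
  · exact fun X _ hX => (hX (h X)).elim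
  · exact fun h => (h (mem_admissibleSets.2 (admissible_empty (isCorePair_empty k)))).elim

/-- Admissible sets of the union are pairs of admissible sets, and minors of the union are unions of
minors. -/
theorem coproductSum_disjUnion {P Q : MarkedGraph} (hP : IsCorePair k P) (hQ : IsCorePair k Q) :
    coproductSum k (P.disjUnion Q) = coproductSum k P * coproductSum k Q := by
  have hl := isComponentMap_inl P Q
  have hr := isComponentMap_inr P Q
  rw [coproductSum, coproductSum, coproductSum, Finset.sum_mul_sum, ← Finset.sum_product']
  refine Finset.sum_nbij' (fun X => ((Sum.inl : P.H → (P.disjUnion Q).H) ⁻¹' X,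
    (Sum.inr : Q.H → (P.disjUnion Q).H) ⁻¹' X)) (fun X => sumSet X.1 X.2) ?_ ?_ ?_ ?_ ?_
  · intro X hX
    rw [mem_admissibleSets, admissible_disjUnion_iff] at hX
    rw [Finset.mem_product, mem_admissibleSets, mem_admissibleSets]
    exact hX
  · intro X hX
    rw [Finset.mem_product, mem_admissibleSets, mem_admissibleSets] at hX
    exact mem_admissibleSets.2 (admissible_disjUnion_iff.2 hX)
  · intro X _
    ext x
    rcases x with x | x <;> exact Iff.rfl
  · exact fun X _ => rfl
  · intro X hX
    rw [mem_admissibleSets] at hX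
    obtain ⟨hX1, hX2⟩ := admissible_disjUnion_iff.1 hX
    have e1 := gfClass_congr (k := k) (nonempty_iso_minor_disjUnion hX.edges isEdgeSet_empty)
    have e2 := gfClass_congr (k := k) (nonempty_iso_minor_disjUnion isEdgeSet_internal hX.edges)
    have i1 : (Sum.inl : P.H → (P.disjUnion Q).H) ⁻¹' (P.disjUnion Q).internal = P.internal :=
      hl.preimage_internal
    have i2 : (Sum.inr : Q.H → (P.disjUnion Q).H) ⁻¹' (P.disjUnion Q).internal = Q.internal :=
      hr.preimage_internal
    change gfClass k ((P.minor ∅ _).disjUnion (Q.minor ∅ _)) = _ at e1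
    rw [i1, i2, gfClass_disjUnion (hP.isCorePair_quot hX1) (hQ.isCorePair_quot hX2)] at e2
    rw [gfClass_disjUnion (hP.isCorePair_sub hX1) (hQ.isCorePair_sub hX2)] at e1
    rw [← e1, ← e2, map_mul, map_mul, Algebra.TensorProduct.tmul_mul_tmul]

/-- The coproduct of the basis elements. -/
noncomputable def comulHom (k : ℕ) : GFClass k →* HGF k ⊗[ℚ] HGF k where
  toFun := Quotient.lift (fun P : CorePair k => coproductSum k P.1)
    (fun _ _ ⟨e⟩ => coproductSum_congr e)
  map_one' := coproductSum_empty
  map_mul' := by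
    rintro ⟨P⟩ ⟨Q⟩
    exact coproductSum_disjUnion P.2 Q.2

theorem comulHom_gfClass {P : MarkedGraph} (hP : IsCorePair k P) :
    comulHom k (gfClass k P) = coproductSum k P := by
  rw [gfClass_eq hP]
  rfl

open Classical in
/-- The counit on the basis elements. -/
noncomputable def counitHom (k : ℕ) : GFClass k →* ℚ where
  toFun m := if m = 1 then 1 else 0
  map_one' := if_pos rfl
  map_mul' := by
    intro m n
    obtain ⟨⟨P, hP⟩, rfl⟩ := Quotient.exists_rep m
    obtain ⟨⟨Q, hQ⟩, rfl⟩ := Quotient.exists_rep n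
    rw [← gfClass_eq hP, ← gfClass_eq hQ, ← gfClass_disjUnion hP hQ]
    have : gfClass k (P.disjUnion Q) = 1 ↔ gfClass k P = 1 ∧ gfClass k Q = 1 := by
      rw [gfClass_eq_one_iff (isCorePair_disjUnion hP hQ), gfClass_eq_one_iff hP,
        gfClass_eq_one_iff hQ]
      exact isEmpty_sum
    simp only [this]
    split_ifs <;> simp_all

theorem lift_counitHom_of_isEmpty {P : MarkedGraph} (hP : IsCorePair k P) (h : IsEmpty P.H) :
    lift (counitHom k) (of k (gfClass k P)) = 1 := by
  rw [lift_of]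
  exact if_pos ((gfClass_eq_one_iff hP).2 h)

theorem lift_counitHom_of_not_isEmpty {P : MarkedGraph} (hP : IsCorePair k P)
    (h : ¬ IsEmpty P.H) : lift (counitHom k) (of k (gfClass k P)) = 0 := by
  rw [lift_of]
  exact if_neg fun h' => h ((gfClass_eq_one_iff hP).1 h')

theorem lift_comulHom {P : MarkedGraph} (hP : IsCorePair k P) :
    lift (comulHom k) (of k (gfClass k P)) = coproductSum k P := by
  rw [lift_of, comulHom_gfClass hP]

/-- Both sides equal the sum of `g Y X` over chains `Y ⊆ X` of admissible sets. On the left `X` is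
chosen first and `Y` inside the subgraph; on the right `Y` comes first and `X` is found in the
quotient. -/
theorem coassoc {P : MarkedGraph} (hP : IsCorePair k P) :
    Algebra.TensorProduct.assoc ℚ ℚ ℚ (HGF k) (HGF k) (HGF k)
      (Algebra.TensorProduct.map (lift (comulHom k)) (AlgHom.id ℚ (HGF k)) (coproductSum k P)) =
    Algebra.TensorProduct.map (AlgHom.id ℚ (HGF k)) (lift (comulHom k)) (coproductSum k P) := by
  classical
  let g : Set P.H → Set P.H → HGF k ⊗[ℚ] (HGF k ⊗[ℚ] HGF k) := fun Y X =>
    of k (gfClass k (P.minor ∅ Y)) ⊗ₜ[ℚ]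
      (of k (gfClass k (P.minor Y X)) ⊗ₜ[ℚ] of k (gfClass k (P.minor X P.internal)))
  trans ∑ X ∈ admissibleSets k P, ∑ Y ∈ admissibleSets k P with Y ⊆ X, g Y X
  · nth_rw 1 [coproductSum]
    rw [map_sum, map_sum]
    refine Finset.sum_congr rfl fun X hX => ?_
    rw [mem_admissibleSets] at hX
    rw [Algebra.TensorProduct.map_tmul, lift_comulHom (hP.isCorePair_sub hX), coproductSum,
      sum_admissibleSets_sub hX, TensorProduct.sum_tmul, map_sum]
    refine Finset.sum_congr rfl fun Y hY => ?_
    rw [Finset.mem_filter, mem_admissibleSets] at hY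
    -- The subgraph of the subgraph is `P.minor ∅ Y`, and the quotient of the subgraph is the middle
    -- factor `P.minor Y X`.
    have e1 := gfClass_congr (k := k) (nonempty_iso_minor_minor hX.edges isEdgeSet_empty
      hY.1.edges isEdgeSet_empty subset_rfl (Set.empty_subset _) hY.2)
    have e2 := gfClass_congr (k := k) (nonempty_iso_minor_minor hX.edges isEdgeSet_empty
      hX.edges hY.1.edges (Set.empty_subset _) hY.2 subset_rfl)
    rw [Set.preimage_empty] at e1
    rw [internal_minor hX.edges isEdgeSet_empty, e1, e2, Algebra.TensorProduct.assoc_tmul]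
    rfl
  · nth_rw 1 [coproductSum]
    rw [map_sum]
    simp only [Finset.sum_filter]
    rw [Finset.sum_comm]
    refine Finset.sum_congr rfl fun Y hY => ?_
    rw [mem_admissibleSets] at hY
    have hI : P.IsEdgeSet P.internal := isEdgeSet_internal
    rw [Algebra.TensorProduct.map_tmul, lift_comulHom (hP.isCorePair_quot hY), coproductSum,
      sum_admissibleSets_quot hY, TensorProduct.tmul_sum, Finset.sum_filter]
    refine Finset.sum_congr rfl fun X hX => ?_
    rw [mem_admissibleSets] at hX
    split_ifs with hYX
    -- The subgraph of the quotient is the middle factor `P.minor Y X`, and the quotient of the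
    -- quotient is `P.minor X P.internal`.
    · have e1 := gfClass_congr (k := k) (nonempty_iso_minor_minor hI hY.edges
        hX.edges hY.edges subset_rfl hYX hX.edges.subset_internal)
      have e2 := gfClass_congr (k := k) (nonempty_iso_minor_minor hI hY.edges
        hI hX.edges hYX hX.edges.subset_internal subset_rfl)
      have e0 : P.minorVal Y P.internal ⁻¹' Y = ∅ :=
        Set.eq_empty_of_forall_notMem fun a => minorVal_notMem a
      rw [e0] at e1
      rw [internal_minor hI hY.edges, e1, e2]
      rfl
    · rfl

theorem rTensor_counit {P : MarkedGraph} (hP : IsCorePair k P) :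
    Algebra.TensorProduct.map (lift (counitHom k)) (AlgHom.id ℚ (HGF k)) (coproductSum k P) =
      1 ⊗ₜ[ℚ] of k (gfClass k P) := by
  rw [coproductSum, map_sum, Finset.sum_eq_single ∅]
  · rw [Algebra.TensorProduct.map_tmul,
      lift_counitHom_of_isEmpty (hP.isCorePair_sub (admissible_empty hP))
        (isEmpty_minor_iff.2 subset_rfl), gfClass_congr hP.nonempty_iso_minor_empty_internal]
    rfl
  · intro X hX hX0
    rw [mem_admissibleSets] at hX
    rw [Algebra.TensorProduct.map_tmul,
      lift_counitHom_of_not_isEmpty (hP.isCorePair_sub hX), TensorProduct.zero_tmul]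
    rw [isEmpty_minor_iff, Set.subset_empty_iff]
    exact hX0
  · exact fun h => (h (mem_admissibleSets.2 (admissible_empty hP))).elim

theorem lTensor_counit {P : MarkedGraph} (hP : IsCorePair k P) :
    Algebra.TensorProduct.map (AlgHom.id ℚ (HGF k)) (lift (counitHom k)) (coproductSum k P) =
      of k (gfClass k P) ⊗ₜ[ℚ] 1 := by
  rw [coproductSum, map_sum, Finset.sum_eq_single P.internal]
  · rw [Algebra.TensorProduct.map_tmul,
      lift_counitHom_of_isEmpty (hP.isCorePair_quot (admissible_internal hP))
        (isEmpty_minor_iff.2 subset_rfl), gfClass_congr hP.nonempty_iso_minor_empty_internal]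
    rfl
  · intro X hX hXI
    rw [mem_admissibleSets] at hX
    rw [Algebra.TensorProduct.map_tmul,
      lift_counitHom_of_not_isEmpty (hP.isCorePair_quot hX), TensorProduct.tmul_zero]
    rw [isEmpty_minor_iff]
    exact fun h => hXI (hX.edges.subset_internal.antisymm h)
  · exact fun h => (h (mem_admissibleSets.2 (admissible_internal hP))).elim

/-- The bialgebra of pairs of a core graph and a spanning forest. -/
@[reducible] noncomputable def bialgebra (k : ℕ) : Bialgebra ℚ (HGF k) :=
  Bialgebra.ofAlgHom (lift (comulHom k)) (lift (counitHom k))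
    (AlgHom.toLinearMap_injective (linearMap_ext fun P hP => by
      change Algebra.TensorProduct.assoc ℚ ℚ ℚ (HGF k) (HGF k) (HGF k)
        (Algebra.TensorProduct.map _ _ (lift (comulHom k) (of k (gfClass k P)))) =
        Algebra.TensorProduct.map _ _ (lift (comulHom k) (of k (gfClass k P)))
      rw [lift_comulHom hP]
      exact coassoc hP))
    (AlgHom.toLinearMap_injective (linearMap_ext fun P hP => by
      change Algebra.TensorProduct.map _ _ (lift (comulHom k) (of k (gfClass k P))) = _
      rw [lift_comulHom hP]
      exact rTensor_counit hP))
    (AlgHom.toLinearMap_injective (linearMap_ext fun P hP => by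
      change Algebra.TensorProduct.map _ _ (lift (comulHom k) (of k (gfClass k P))) = _
      rw [lift_comulHom hP]
      exact lTensor_counit hP))

end HGF

/-! ### The antipode -/

namespace HGF

variable {k : ℕ}

attribute [local instance] HGF.bialgebra

theorem comul_of {P : MarkedGraph} (hP : IsCorePair k P) :
    Coalgebra.comul (R := ℚ) (of k (gfClass k P)) = coproductSum k P := lift_comulHom hP

theorem convMul_of (f g : WithConv (HGF k →ₗ[ℚ] HGF k)) {P : MarkedGraph}
    (hP : IsCorePair k P) :
    (f * g) (of k (gfClass k P)) = ∑ X ∈ admissibleSets k P,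
      f (of k (gfClass k (P.minor ∅ X))) * g (of k (gfClass k (P.minor X P.internal))) := by
  rw [LinearMap.convMul_apply, comul_of hP, coproductSum, map_sum, map_sum]
  exact Finset.sum_congr rfl fun X _ => by
    rw [TensorProduct.map_tmul, LinearMap.mul'_apply]

theorem convOne_of_isEmpty {P : MarkedGraph} (hP : IsCorePair k P) (h : IsEmpty P.H) :
    (1 : WithConv (HGF k →ₗ[ℚ] HGF k)) (of k (gfClass k P)) = 1 := by
  rw [LinearMap.convOne_apply]
  change algebraMap ℚ (HGF k) (lift (counitHom k) _) = 1
  rw [lift_counitHom_of_isEmpty hP h, map_one]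

/-- The difference of the convolution unit and the identity. It is locally nilpotent. -/
noncomputable def oneSubId (k : ℕ) : WithConv (HGF k →ₗ[ℚ] HGF k) :=
  1 - WithConv.toConv LinearMap.id

theorem oneSubId_of_isEmpty {P : MarkedGraph} (hP : IsCorePair k P) (h : IsEmpty P.H) :
    oneSubId k (of k (gfClass k P)) = 0 := by
  have h1 : gfClass k P = 1 := (gfClass_eq_one_iff hP).2 h
  have h2 := convOne_of_isEmpty hP h
  change (1 : WithConv (HGF k →ₗ[ℚ] HGF k)) (of k (gfClass k P)) - of k (gfClass k P) = 0
  rw [h2, h1, map_one, sub_self]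

/-- In the convolution with one more factor, the term with `X = ∅` vanishes because `oneSubId` kills
the empty pair. In all other terms the quotient has fewer edges, and the induction hypothesis
applies to it. -/
theorem oneSubId_pow {n : ℕ} {P : MarkedGraph} (hP : IsCorePair k P)
    (hn : P.internal.ncard < n) : (oneSubId k ^ n) (of k (gfClass k P)) = 0 := by
  induction n generalizing P with
  | zero => omega
  | succ n ih =>
    rw [pow_succ', convMul_of _ _ hP]
    refine Finset.sum_eq_zero fun X hX => ?_
    rw [mem_admissibleSets] at hX
    rcases X.eq_empty_or_nonempty with rfl | hne
    · rw [oneSubId_of_isEmpty (hP.isCorePair_sub hX) (isEmpty_minor_iff.2 subset_rfl), zero_mul]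
    · have h1 := ncard_internal_minor isEdgeSet_internal hX.edges hX.edges.subset_internal
      have h2 := (Set.ncard_pos (Set.toFinite X)).2 hne
      rw [ih (hP.isCorePair_quot hX) (by omega), mul_zero]

theorem geomSum_of_le {m n : ℕ} (hmn : m ≤ n) {P : MarkedGraph} (hP : IsCorePair k P)
    (hm : P.internal.ncard < m) :
    (∑ i ∈ Finset.range m, oneSubId k ^ i) (of k (gfClass k P)) =
      (∑ i ∈ Finset.range n, oneSubId k ^ i) (of k (gfClass k P)) := by
  induction n, hmn using Nat.le_induction with
  | base => rfl
  | succ n hn ih =>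
    rw [Finset.sum_range_succ]
    change _ = (∑ i ∈ Finset.range n, oneSubId k ^ i) (of k (gfClass k P)) +
      (oneSubId k ^ n) (of k (gfClass k P))
    rw [oneSubId_pow hP (by omega), add_zero, ih]

/-- The antipode: the geometric series of `oneSubId`. -/
noncomputable def antipodeMap (k : ℕ) : HGF k →ₗ[ℚ] HGF k :=
  (basis k).constr ℚ fun m =>
    -- The chosen representative serves only to cut off the series. The `+ 1` gives the strict
    -- inequality of `oneSubId_pow`, and any longer sum has the same value by `geomSum_of_le`.
    (∑ i ∈ Finset.range ((Quotient.out m).1.internal.ncard + 1), oneSubId k ^ i) (of k m)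

theorem antipodeMap_of {n : ℕ} {P : MarkedGraph} (hP : IsCorePair k P)
    (hn : P.internal.ncard < n) : antipodeMap k (of k (gfClass k P)) =
      (∑ i ∈ Finset.range n, oneSubId k ^ i) (of k (gfClass k P)) := by
  set Q := Quotient.out (gfClass k P) with hQ
  have h1 : gfClass k Q.1 = gfClass k P := by
    rw [gfClass_eq Q.2]
    exact Quotient.out_eq _
  have h2 : antipodeMap k (of k (gfClass k P)) =
      (∑ i ∈ Finset.range (Q.1.internal.ncard + 1), oneSubId k ^ i) (of k (gfClass k P)) := by
    rw [← basis_apply]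
    exact (basis k).constr_basis ℚ _ _
  have h3 := geomSum_of_le (le_max_left n (Q.1.internal.ncard + 1)) hP hn
  have h4 := geomSum_of_le (le_max_right n (Q.1.internal.ncard + 1)) Q.2 (Nat.lt_succ_self _)
  rw [h1] at h4
  exact h2.trans (h4.trans h3.symm)

theorem id_eq_one_sub (k : ℕ) :
    WithConv.toConv (LinearMap.id : HGF k →ₗ[ℚ] HGF k) = 1 - oneSubId k :=
  (sub_sub_cancel _ _).symm

theorem antipodeMap_mul_id (k : ℕ) :
    WithConv.toConv (antipodeMap k) * WithConv.toConv LinearMap.id = 1 := by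
  refine WithConv.ext (linearMap_ext fun P hP => ?_)
  -- Subgraphs have no more edges than `P`, so one finite geometric sum represents the antipode in
  -- all terms. Multiplying it by `1 - oneSubId k` telescopes, and the remaining power vanishes on
  -- `P`.
  have key : (WithConv.toConv (antipodeMap k) * WithConv.toConv LinearMap.id :
      WithConv (HGF k →ₗ[ℚ] HGF k)) (of k (gfClass k P)) =
      ((∑ i ∈ Finset.range (P.internal.ncard + 1), oneSubId k ^ i) *
        WithConv.toConv LinearMap.id : WithConv (HGF k →ₗ[ℚ] HGF k)) (of k (gfClass k P)) := by
    rw [convMul_of _ _ hP, convMul_of _ _ hP]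
    refine Finset.sum_congr rfl fun X hX => ?_
    rw [mem_admissibleSets] at hX
    have h1 := ncard_internal_minor hX.edges isEdgeSet_empty (Set.empty_subset _)
    have h2 := Set.ncard_le_ncard hX.edges.subset_internal
    rw [Set.ncard_empty] at h1
    exact congrArg (· * _) (antipodeMap_of (hP.isCorePair_sub hX) (by omega))
  refine key.trans ?_
  rw [id_eq_one_sub, geom_sum_mul_neg]
  change (1 : WithConv (HGF k →ₗ[ℚ] HGF k)) _ - (oneSubId k ^ _) _ = _
  rw [oneSubId_pow hP (Nat.lt_succ_self _), sub_zero]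

theorem id_mul_antipodeMap (k : ℕ) :
    WithConv.toConv LinearMap.id * WithConv.toConv (antipodeMap k) = 1 := by
  refine WithConv.ext (linearMap_ext fun P hP => ?_)
  have key : (WithConv.toConv LinearMap.id * WithConv.toConv (antipodeMap k) :
      WithConv (HGF k →ₗ[ℚ] HGF k)) (of k (gfClass k P)) = (WithConv.toConv LinearMap.id *
        (∑ i ∈ Finset.range (P.internal.ncard + 1), oneSubId k ^ i) :
        WithConv (HGF k →ₗ[ℚ] HGF k)) (of k (gfClass k P)) := by
    rw [convMul_of _ _ hP, convMul_of _ _ hP]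
    refine Finset.sum_congr rfl fun X hX => ?_
    rw [mem_admissibleSets] at hX
    have h1 := ncard_internal_minor isEdgeSet_internal hX.edges hX.edges.subset_internal
    exact congrArg (_ * ·) (antipodeMap_of (hP.isCorePair_quot hX) (by omega))
  refine key.trans ?_
  rw [id_eq_one_sub, mul_neg_geom_sum]
  change (1 : WithConv (HGF k →ₗ[ℚ] HGF k)) _ - (oneSubId k ^ _) _ = _
  rw [oneSubId_pow hP (Nat.lt_succ_self _), sub_zero]

/-- The Hopf algebra of pairs of a core graph and a spanning forest. -/
@[reducible] noncomputable def hopfAlgebra (k : ℕ) : HopfAlgebra ℚ (HGF k) :=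
  HopfAlgebra.ofConvInverse (antipodeMap k) (antipodeMap_mul_id k) (id_mul_antipodeMap k)

end HGF

/-! ### Comparison with the coproduct of connected pairs -/

namespace MarkedGraph

variable {P : MarkedGraph} {k : ℕ} {X : Set P.H}

theorem sub_flip_val (hX : P.IsEdgeSet X) {h : (P.sub X hX).H} (hh : h.1 ∈ X) :
    ((P.sub X hX).flip h).1 = P.flip h.1 :=
  congrArg Subtype.val (dif_pos hh)

theorem sub_flip_of_notMem (hX : P.IsEdgeSet X) {h : (P.sub X hX).H} (hh : h.1 ∉ X) :
    (P.sub X hX).flip h = h := dif_neg hh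

theorem nonempty_iso_sub (hX : P.IsEdgeSet X) :
    Nonempty (Iso (P.minor ∅ X) (P.sub X hX)) := by
  refine nonempty_iso_of_maps (P.minorVal ∅ X) (fun h : (P.sub X hX).H => h.1)
    minorVal_injective Subtype.val_injective ?_ ?_ ?_ ?_ ?_
  · intro a
    obtain ⟨x, hx, -, hc⟩ := exists_conn_minorVal a
    exact ⟨⟨_, x, hx, conn_empty.1 hc⟩, rfl⟩
  · rintro ⟨b, x, hx, hv⟩
    exact exists_minorVal_eq (Set.notMem_empty _) hx (Set.notMem_empty _) (conn_of_vert hv)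
  · intro a b a' b' ha hb
    rw [minor_vert, ← ha, ← hb]
    exact (conn_empty (a := a'.1) (b := b'.1)).symm
  · intro a a' ha
    change a'.1 = _ at ha
    by_cases haX : P.minorVal ∅ X a ∈ X
    · rw [minorVal_flip hX isEdgeSet_empty haX, sub_flip_val hX (ha ▸ haX), ha]
    · rw [minor_flip_of_notMem haX, sub_flip_of_notMem hX (ha ▸ haX), ha]
  · intro a a' ha
    rw [mem_minor_F, ← ha]
    rfl

/-- `contract` keeps every vertex that still has a half-edge, while the minor keeps only those at
which an internal edge survives. If everything is active, these are the same. -/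
theorem nonempty_iso_contract (hX : P.IsEdgeSet X) (hP : P.IsEdgeSet P.F)
    (hact : ∀ h, P.IsActive X h) :
    Nonempty (Iso (P.minor X P.internal) (P.contract X hX)) := by
  refine nonempty_iso_of_maps (P.minorVal X P.internal) (fun h : (P.contract X hX).H => h.1)
    minorVal_injective Subtype.val_injective ?_ ?_ ?_ ?_ ?_
  · exact fun a => ⟨⟨_, minorVal_notMem a⟩, rfl⟩
  · intro b
    obtain ⟨x, hx, hxX, hc⟩ := hact b.1
    exact exists_minorVal_eq b.2 hx hxX hc
  · intro a b a' b' ha hb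
    rw [minor_vert, ← ha, ← hb]
    rfl
  · intro a a' ha
    change P.flip a'.1 = _
    change a'.1 = _ at ha
    by_cases haX : P.minorVal X P.internal a ∈ P.internal
    · rw [minorVal_flip isEdgeSet_internal hX haX, ha]
    · rw [minor_flip_of_notMem haX, ha]
      exact not_not.1 haX
  · intro a a' ha
    rw [mem_minor_F, ← ha]
    exact ⟨fun h => ⟨h, hP.subset_internal h⟩, And.left⟩

theorem contract_conn (hX : P.IsEdgeSet X) {Z : Set (P.contract X hX).H}
    {a b : (P.contract X hX).H} :
    (P.contract X hX).conn Z a b ↔ P.conn (X ∪ (fun h => h.1) '' Z) a.1 b.1 :=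
  conn_iff_of_vert (R := (P.contract X hX).toFeynmanGraph) (fun h => h.1) (fun _ _ => Iff.rfl)
    (fun _ _ => rfl)

theorem contract_conn_F (hX : P.IsEdgeSet X) {a b : (P.contract X hX).H} :
    (P.contract X hX).conn (P.contract X hX).F a b ↔ P.conn (X ∪ P.F) a.1 b.1 := by
  have e : X ∪ (fun h : (P.contract X hX).H => h.1) '' (P.contract X hX).F = X ∪ P.F := by
    ext x
    constructor
    · rintro (hx | ⟨a, ha, rfl⟩)
      · exact Or.inl hx
      · exact Or.inr ha
    · rintro (hx | hx)
      · exact Or.inl hx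
      · by_cases hxX : x ∈ X
        · exact Or.inl hxX
        · exact Or.inr ⟨⟨x, hxX⟩, hx, rfl⟩
  rw [contract_conn, e]

/-- Components are counted as classes of half-edges; activity ensures that each has a half-edge
outside `X`, so that none is lost in the contraction. -/
theorem numComponents_contract (hX : P.IsEdgeSet X) (hact : ∀ h, P.IsActive X h) :
    (P.contract X hX).numComponents (P.contract X hX).F = P.numComponents (X ∪ P.F) := by
  have e : (P.contract X hX).conn (P.contract X hX).F =
      (P.conn (X ∪ P.F)).comap (fun h : (P.contract X hX).H => h.1) :=
    Setoid.ext fun a b => contract_conn_F hX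
  rw [numComponents, e, Setoid.card_quotient_comap, numComponents]
  intro a
  obtain ⟨x, -, hxX, hc⟩ := hact a
  exact ⟨⟨x, hxX⟩, conn_mono Set.subset_union_left (Setoid.symm' _ hc)⟩

theorem sameTreeNumber_of_conn_le (hX : P.IsEdgeSet X) (hact : ∀ h, P.IsActive X h)
    (h : ∀ a b, P.conn (X ∪ P.F) a b → P.conn P.F a b) : P.SameTreeNumber X hX := by
  have e : P.conn (X ∪ P.F) = P.conn P.F :=
    le_antisymm (fun a b => h a b) (fun _ _ => conn_mono Set.subset_union_right)
  rw [SameTreeNumber, numComponents_contract hX hact, numComponents, numComponents, e]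

/-- Adding `X` to the forest maps its trees onto the components of `X ∪ P.F`. A surjection between
finite sets of equal size is injective, so `X` merges no two trees. -/
theorem SameTreeNumber.conn_le (hX : P.IsEdgeSet X) (hact : ∀ h, P.IsActive X h)
    (h : P.SameTreeNumber X hX) {a b : P.H} (hab : P.conn (X ∪ P.F) a b) : P.conn P.F a b := by
  rw [SameTreeNumber, numComponents_contract hX hact] at h
  let u : Quotient (P.conn P.F) → Quotient (P.conn (X ∪ P.F)) :=
    Quotient.map' id (fun _ _ h => conn_mono Set.subset_union_right h)
  have hu : Function.Surjective u := by
    rintro ⟨a⟩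
    exact ⟨Quotient.mk _ a, rfl⟩
  have hb := hu.bijective_of_nat_card_le h.le
  have : (Quotient.mk (P.conn P.F) a) = Quotient.mk _ b := hb.1 (Quotient.sound hab)
  exact Quotient.exact this

/-- If the forest without the edges of `X` is a forest of the graph in which `X` is contracted, then
paths in the forest between half-edges that are joined by `X` run through `X`. -/
theorem conn_inter_of_acyclic_contract (hX : P.IsEdgeSet X)
    (hac : (P.contract X hX).IsAcyclic (P.contract X hX).F) {a b : P.H} (hab : P.conn X a b)
    {Z : Set P.H} (hZ : P.IsEdgeSet Z) (hZF : Z ⊆ P.F) (hc : P.conn Z a b) :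
    P.conn (P.F ∩ X) a b := by
  induction hn : Z.ncard using Nat.strong_induction_on generalizing Z with
  | _ n ih =>
    by_cases hZX : Z ⊆ X
    · exact conn_mono (Set.subset_inter hZF hZX) hc
    obtain ⟨e, heZ, heX⟩ := Set.not_subset.1 hZX
    have hlt := hZ.ncard_diff_edge heZ
    -- An edge of the forest outside `X` survives in the contraction, where acyclicity forbids
    -- joining its ends by the other forest edges together with `X`.
    have hnot : ¬ P.conn (Z \ {e, P.flip e} ∪ X) e (P.flip e) := by
      intro h
      refine hac ⟨e, heX⟩ (hZF heZ) ((contract_conn hX).2 (conn_mono ?_ h))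
      rintro y (⟨hy, hye⟩ | hy)
      · by_cases hyX : y ∈ X
        · exact Or.inl hyX
        · refine Or.inr ⟨⟨y, hyX⟩, ⟨hZF hy, ?_⟩, rfl⟩
          rintro (h | h)
          · exact hye (Or.inl (congrArg (fun x : (P.contract X hX).H => x.1) h))
          · exact hye (Or.inr (congrArg (fun x : (P.contract X hX).H => x.1) h))
      · exact Or.inl hy
    have hab' : P.conn (Z \ {e, P.flip e} ∪ X) a b := conn_mono Set.subset_union_right hab
    -- A path crossing `e` would, closed up by the connection of `a` and `b` in `X`, join the ends
    -- of `e` without using `e`. So `e` can be dropped from `Z`.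
    rcases conn_insert_edge (e := e) hc with h | ⟨h1, h2⟩ | ⟨h1, h2⟩
    · exact ih _ (by omega) (hZ.diff_edge e) (Set.sdiff_subset.trans hZF) h rfl
    · refine (hnot ?_).elim
      exact Setoid.trans' _ (Setoid.symm' _ (conn_mono Set.subset_union_left h1))
        (Setoid.trans' _ hab' (Setoid.symm' _ (conn_mono Set.subset_union_left h2)))
    · refine (hnot ?_).elim
      exact Setoid.trans' _ (conn_mono Set.subset_union_left h2)
        (Setoid.trans' _ (Setoid.symm' _ hab') (conn_mono Set.subset_union_left h1))

theorem isActive_of_isConnected (hP : P.IsConnected) (hX : P.IsEdgeSet X) (hXI : X ≠ P.internal)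
    (h : P.H) : P.IsActive X h := by
  obtain ⟨x, hx, hxX⟩ : ∃ x ∈ P.internal, x ∉ X := by
    by_contra! hn
    exact hXI (hX.subset_internal.antisymm hn)
  exact IsActive.conn_internal hX ⟨x, hx, hxX, Setoid.refl' _ _⟩ (hP.2 x h)

/-- For a connected graph, the admissible sets of edges, other than the trivial ones, are the
index set of the reduced coproduct. -/
theorem admissible_iff_of_isConnected {P : CorePair k} (hP : P.1.IsConnected) {X : Set P.1.H}
    (hne : X.Nonempty) (hXI : X ≠ P.1.internal) :
    Admissible k P.1 X ↔ ∃ h : P.IsProperCoreSubgraph X,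
      P.1.SameLegPartition X h.edges ∧ P.1.SameTreeNumber X h.edges := by
  constructor
  · intro h
    have hact := isActive_of_isConnected hP h.edges hXI
    obtain ⟨e1⟩ := nonempty_iso_sub h.edges
    obtain ⟨e2⟩ := nonempty_iso_contract h.edges P.2.edges hact
    -- Each edge of `X` is replaced by a path in `F ∩ X`, so contracting `X` joins no two trees.
    -- This gives both the leg partition and the number of trees.
    have hle : ∀ a b, P.1.conn (X ∪ P.1.F) a b → P.1.conn P.1.F a b := fun a b hab => by
      refine conn_le (fun _ _ => conn_of_vert) (fun x hx => ?_) hab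
      rcases hx with hx | hx
      · exact conn_mono Set.inter_subset_left ((h x).spans (hact x) _ (conn_flip hx))
      · exact conn_flip hx
    refine ⟨⟨h.edges, hne, hXI, e1.isCorePair (P.2.isCorePair_sub h),
      e2.isCorePair (P.2.isCorePair_quot h)⟩, fun a b _ _ => ?_,
      sameTreeNumber_of_conn_le _ hact hle⟩
    rw [contract_conn_F]
    exact ⟨conn_mono Set.subset_union_right, hle _ _⟩
  · rintro ⟨h, -, htree⟩ a
    have hX := h.edges
    have hsub := h.sub
    have hquot := h.contract
    have hact := isActive_of_isConnected hP hX hXI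
    refine ⟨fun ha => (hX a ha).1, fun ha => (hX a ha).2, fun ha => ?_, fun _ b hab => ?_,
      fun _ => ?_⟩
    · let a' : (P.1.sub X hX).H := ⟨a, a, ha, Setoid.refl' _ _⟩
      have hfa : ((P.1.sub X hX).flip a').1 = P.1.flip a := sub_flip_val hX ha
      have hmem : ∀ b : (P.1.sub X hX).H, b ∈ (P.1.sub X hX).internal → b.1 ∈ X := fun b hb =>
        by_contra fun hbX => hb (sub_flip_of_notMem hX hbX)
      have ha' : a' ∈ (P.1.sub X hX).internal := fun e =>
        (hX a ha).2 (hfa.symm.trans (congrArg (fun x => x.1) e))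
      have hc := conn_map (G := (P.1.sub X hX).toFeynmanGraph) (G' := P.1.toFeynmanGraph)
        (X' := X \ {a, P.1.flip a}) (fun h => h.1) (fun _ _ h => h) (fun b hb => ?_)
        (hsub.bridgeless a' ha')
      · change P.1.conn _ a ((P.1.sub X hX).flip a').1 at hc
        rwa [hfa] at hc
      · refine ⟨⟨hmem b hb.1, ?_⟩, sub_flip_val hX (hmem b hb.1)⟩
        rintro (h | h)
        · exact hb.2 (Or.inl (Subtype.ext h))
        · exact hb.2 (Or.inr (Subtype.ext (h.trans hfa.symm)))
    -- Equality of the numbers of trees yields a path in `F` between half-edges joined by `X`;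
    -- acyclicity of the contracted forest forces such a path into `X`.
    · exact conn_inter_of_acyclic_contract hX hquot.acyclic hab P.2.edges subset_rfl
        (SameTreeNumber.conn_le hX hact htree (conn_mono Set.subset_union_left hab))
    · obtain ⟨x, -, hxX, hc⟩ := hact a
      -- The half-edge `a` may lie in `X` and be absent from the contraction, so the valence is read
      -- off at `x` in the same `X`-component.
      refine (hquot.valence ⟨x, hxX⟩).trans_eq (Nat.card_congr (Equiv.ofBijective
        (fun y => ⟨y.1.1, y.1.2, Setoid.trans' _ hc y.2⟩) ⟨?_, ?_⟩))
      · intro y z hyz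
        exact Subtype.ext (Subtype.ext (congrArg (fun x => x.1) hyz))
      · rintro ⟨y, hyX, hy⟩
        exact ⟨⟨⟨y, hyX⟩, Setoid.trans' (P.1.conn X) (Setoid.symm' (P.1.conn X) hc) hy⟩, rfl⟩

/-- If `X` merged two trees that carry legs, these legs would be joined in the quotient but not in
`F`, against the leg partition. For a spanning tree there is nothing to merge. -/
theorem SameLegPartition.sameTreeNumber (hX : P.IsEdgeSet X) (hact : ∀ h, P.IsActive X h)
    (h : P.EveryTreeHasLeg ∨ P.IsTree) (hleg : P.SameLegPartition X hX) :
    P.SameTreeNumber X hX := by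
  refine sameTreeNumber_of_conn_le hX hact fun a b hab => ?_
  rcases h with h | h
  · obtain ⟨l, hl, hal⟩ := h a
    obtain ⟨m, hm, hbm⟩ := h b
    have hlX : l ∉ X := fun h => (hX l h).2 hl
    have hmX : m ∉ X := fun h => (hX m h).2 hm
    refine Setoid.trans' _ hal (Setoid.trans' _ ((hleg ⟨l, hlX⟩ ⟨m, hmX⟩ hl hm).2 ?_)
      (Setoid.symm' _ hbm))
    refine (contract_conn_F hX).2 ?_
    exact Setoid.trans' _ (Setoid.symm' _ (conn_mono Set.subset_union_right hal))
      (Setoid.trans' _ hab (conn_mono Set.subset_union_right hbm))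
  · exact h a b

end MarkedGraph

namespace HGF

variable {k : ℕ}

attribute [local instance] HGF.algebra

theorem coproductSum_eq_coproduct {P : CorePair k} (hP : P.1.IsConnected) :
    coproductSum k P.1 = P.coproduct := by
  classical
  set g : Set P.1.H → HGF k ⊗[ℚ] HGF k := fun X =>
    of k (gfClass k (P.1.minor ∅ X)) ⊗ₜ[ℚ] of k (gfClass k (P.1.minor X P.1.internal)) with hg
  have h0 : g ∅ = 1 ⊗ₜ[ℚ] gen P := by
    have h1 : gfClass k (P.1.minor ∅ ∅) = 1 :=
      (gfClass_eq_one_iff (P.2.isCorePair_sub (admissible_empty P.2))).2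
        (isEmpty_minor_iff.2 subset_rfl)
    rw [hg, gen_eq]
    simp only [h1, map_one, gfClass_congr P.2.nonempty_iso_minor_empty_internal]
  have hI : g P.1.internal = gen P ⊗ₜ[ℚ] 1 := by
    have h1 : gfClass k (P.1.minor P.1.internal P.1.internal) = 1 :=
      (gfClass_eq_one_iff (P.2.isCorePair_quot (admissible_internal P.2))).2
        (isEmpty_minor_iff.2 subset_rfl)
    rw [hg, gen_eq]
    simp only [h1, map_one, gfClass_congr P.2.nonempty_iso_minor_empty_internal]
  -- A nonempty core graph has an internal edge, so `∅` and the full edge set are two different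
  -- summands and can be split off separately.
  have hne : P.1.internal ≠ ∅ := by
    obtain ⟨h⟩ := hP.1
    obtain ⟨x, hx, -⟩ := P.2.no_isolated h
    exact Set.nonempty_iff_ne_empty.1 ⟨x, hx⟩
  have hmem : ∀ X : Set P.1.H, X ∈ ((admissibleSets k P.1).erase P.1.internal).erase ∅ ↔
      ∃ h : P.IsProperCoreSubgraph X,
        P.1.SameLegPartition X h.edges ∧ P.1.SameTreeNumber X h.edges := by
    intro X
    rw [Finset.mem_erase, Finset.mem_erase, mem_admissibleSets]
    constructor
    · rintro ⟨h1, h2, h3⟩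
      exact (admissible_iff_of_isConnected hP (Set.nonempty_iff_ne_empty.2 h1) h2).1 h3
    · intro h
      have hX := h.choose
      exact ⟨hX.nonempty.ne_empty, hX.proper,
        (admissible_iff_of_isConnected hP hX.nonempty hX.proper).2 h⟩
  have hsum : ∑ X : P.CoproductIndex,
      gen (P.subPair X.2.choose) ⊗ₜ[ℚ] gen (P.quotPair X.2.choose) =
      ∑ X ∈ ((admissibleSets k P.1).erase P.1.internal).erase ∅, g X := by
    refine Finset.sum_bij (fun X _ => X.1) (fun X _ => (hmem _).2 X.2)
      (fun X _ Y _ h => Subtype.ext h) (fun X hX => ⟨⟨X, (hmem X).1 hX⟩, Finset.mem_univ _, rfl⟩)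
      (fun X _ => ?_)
    have hX := X.2.choose
    have hact := isActive_of_isConnected hP hX.edges hX.proper
    rw [gen_eq, gen_eq]
    exact congrArg₂ (fun a b => of k a ⊗ₜ[ℚ] of k b)
      (gfClass_congr (nonempty_iso_sub hX.edges)).symm
      (gfClass_congr (nonempty_iso_contract hX.edges P.2.edges hact)).symm
  rw [CorePair.coproduct, hsum, ← h0, ← hI, add_assoc, coproductSum]
  rw [Finset.add_sum_erase _ g, Finset.add_sum_erase _ g]
  · exact mem_admissibleSets.2 (admissible_internal P.2)
  · rw [Finset.mem_erase, mem_admissibleSets]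
    exact ⟨hne.symm, admissible_empty P.2⟩

end HGF

/-! ### The grading by loop number -/

namespace MarkedGraph

variable {P : MarkedGraph} {k : ℕ}

theorem loopNumber_of_isEmpty [IsEmpty P.H] : P.loopNumber = 0 := by
  have h1 := P.loopNumber_add
  have h2 := P.two_mul_numEdges
  have h3 : P.internal = ∅ := Set.eq_empty_of_isEmpty _
  have h4 : P.numComponents P.internal = 0 := by
    rw [numComponents]
    exact Nat.card_of_isEmpty
  rw [h4] at h1
  rw [h3, Set.ncard_empty] at h2
  omega

theorem IsCorePair.isEmpty_of_loopNumber (hP : IsCorePair k P) (h : P.loopNumber = 0) :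
    IsEmpty P.H := by
  refine ⟨fun a => ?_⟩
  obtain ⟨x, hx, -⟩ := hP.no_isolated a
  exact (hP.bridgeless.loopNumber_pos hx).ne' h

end MarkedGraph

namespace HGF

variable {k : ℕ}

attribute [local instance] HGF.algebra

theorem gen_mul_gen (P Q : CorePair k) : gen P * gen Q = gen (P.disjUnion Q) := by
  rw [gen_eq, gen_eq, gen_eq, ← map_mul]
  exact congrArg _ (gfClass_disjUnion P.2 Q.2).symm

theorem gen_mem_degreePart (P : CorePair k) : gen P ∈ degreePart k P.1.loopNumber :=
  Submodule.subset_span ⟨P, rfl, rfl⟩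

theorem of_mem_degreePart {P : MarkedGraph} (hP : IsCorePair k P) :
    of k (gfClass k P) ∈ degreePart k P.loopNumber := by
  have e : gen ⟨P, hP⟩ = of k (gfClass k P) := gen_eq _
  exact e ▸ gen_mem_degreePart ⟨P, hP⟩

theorem gen_of_isEmpty (P : CorePair k) (h : IsEmpty P.1.H) : gen P = 1 := by
  rw [gen_eq, (gfClass_eq_one_iff P.2).2 h, map_one]

theorem degreePart_zero (k : ℕ) : degreePart k 0 = 1 := by
  rw [Submodule.one_eq_span, degreePart]
  congr 1
  ext x
  constructor
  · rintro ⟨P, hP, rfl⟩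
    exact gen_of_isEmpty P (P.2.isEmpty_of_loopNumber hP)
  · rintro rfl
    have : IsEmpty MarkedGraph.empty.H := inferInstanceAs (IsEmpty Empty)
    exact ⟨⟨MarkedGraph.empty, isCorePair_empty k⟩, loopNumber_of_isEmpty,
      (gen_of_isEmpty _ this).symm⟩

theorem degreePart_gradedMonoid (k : ℕ) : SetLike.GradedMonoid (degreePart k) where
  one_mem := by
    rw [degreePart_zero]
    exact Submodule.one_le.1 le_rfl
  mul_mem := by
    intro i j x y hx hy
    have h := Submodule.mul_mem_mul hx hy
    rw [degreePart, degreePart, Submodule.span_mul_span] at h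
    refine Submodule.span_mono ?_ h
    rintro _ ⟨_, ⟨P, rfl, rfl⟩, _, ⟨Q, rfl, rfl⟩, rfl⟩
    exact ⟨P.disjUnion Q, loopNumber_disjUnion P.1 Q.1, gen_mul_gen P Q⟩

/-- The loop number of an isomorphism class. -/
noncomputable def classLoopNumber (k : ℕ) : GFClass k → ℕ :=
  Quotient.lift (fun P : CorePair k => P.1.loopNumber) (fun _ _ ⟨e⟩ => e.loopNumber_eq)

theorem degreePart_eq_span (j : ℕ) :
    degreePart k j = Submodule.span ℚ (basis k '' {m | classLoopNumber k m = j}) := by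
  rw [degreePart]
  congr 1
  ext x
  constructor
  · rintro ⟨P, hP, rfl⟩
    exact ⟨Quotient.mk _ P, hP, basis_apply _⟩
  · rintro ⟨m, hm, rfl⟩
    obtain ⟨P, rfl⟩ := Quotient.exists_rep m
    exact ⟨P, hm, basis_apply _⟩

/-- The loop number partitions the basis of isomorphism classes, and the degree parts are the spans
of the blocks. -/
theorem degreePart_isInternal (k : ℕ) : DirectSum.IsInternal (degreePart k) := by
  refine DirectSum.isInternal_submodule_of_iSupIndep_of_iSup_eq_top ?_ ?_
  · intro i
    rw [degreePart_eq_span]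
    refine ((basis k).linearIndependent.disjoint_span_image
      (t := {m | classLoopNumber k m ≠ i}) ?_).mono_right ?_
    · exact Set.disjoint_left.2 fun m hm hm' => hm' hm
    · refine iSup₂_le fun j hj => ?_
      rw [degreePart_eq_span]
      refine Submodule.span_mono (Set.image_mono ?_)
      rintro m rfl
      exact hj
  · rw [eq_top_iff, ← (basis k).span_eq, Submodule.span_le]
    rintro _ ⟨m, rfl⟩
    refine Submodule.mem_iSup_of_mem (classLoopNumber k m) ?_
    rw [degreePart_eq_span]
    exact Submodule.subset_span ⟨m, rfl, rfl⟩

theorem coproductSum_mem {P : MarkedGraph} (hP : IsCorePair k P) :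
    coproductSum k P ∈ ⨆ (i : ℕ) (j : ℕ) (_ : i + j = P.loopNumber),
      LinearMap.range (TensorProduct.map (degreePart k i).subtype (degreePart k j).subtype) := by
  refine Submodule.sum_mem _ fun X hX => ?_
  rw [mem_admissibleSets] at hX
  refine Submodule.mem_iSup_of_mem _ (Submodule.mem_iSup_of_mem _
    (Submodule.mem_iSup_of_mem (loopNumber_minor_add hX.edges) ?_))
  exact ⟨⟨_, of_mem_degreePart (hP.isCorePair_sub hX)⟩ ⊗ₜ[ℚ]
    ⟨_, of_mem_degreePart (hP.isCorePair_quot hX)⟩, TensorProduct.map_tmul _ _ _ _⟩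

theorem lift_comulHom_mem {n : ℕ} {x : HGF k} (hx : x ∈ degreePart k n) :
    lift (comulHom k) x ∈ ⨆ (i : ℕ) (j : ℕ) (_ : i + j = n),
      LinearMap.range (TensorProduct.map (degreePart k i).subtype (degreePart k j).subtype) := by
  suffices h : degreePart k n ≤ Submodule.comap (lift (comulHom k)).toLinearMap
      (⨆ (i : ℕ) (j : ℕ) (_ : i + j = n), LinearMap.range
        (TensorProduct.map (degreePart k i).subtype (degreePart k j).subtype)) from h hx
  refine Submodule.span_le.2 ?_
  rintro _ ⟨P, rfl, rfl⟩
  rw [SetLike.mem_coe, Submodule.mem_comap, AlgHom.toLinearMap_apply, gen_eq, lift_comulHom P.2]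
  exact coproductSum_mem P.2

end HGF

/-! ### The main theorem -/

theorem mainTheorem5 (k : ℕ) :
    ∃ h : HopfAlgebra ℚ (HGF k),
      h.toAlgebra = HGF.algebra k ∧
      (∀ P Q : CorePair k, HGF.gen P * HGF.gen Q = HGF.gen (P.disjUnion Q)) ∧
      (∀ P : CorePair k, P.1.IsConnected →
        Coalgebra.comul (R := ℚ) (HGF.gen P) = P.coproduct) ∧
      (∀ P : CorePair k, P.1.IsConnected → (P.1.EveryTreeHasLeg ∨ P.1.IsTree) →
        ∀ (X : Set P.1.H) (hX : P.IsProperCoreSubgraph X),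
          P.1.SameLegPartition X hX.edges → P.1.SameTreeNumber X hX.edges) ∧
      (∀ P : CorePair k, IsEmpty P.1.H → Coalgebra.counit (R := ℚ) (HGF.gen P) = 1) ∧
      (∀ P : CorePair k, Nonempty P.1.H → Coalgebra.counit (R := ℚ) (HGF.gen P) = 0) ∧
      SetLike.GradedMonoid (HGF.degreePart k) ∧
      DirectSum.IsInternal (HGF.degreePart k) ∧
      HGF.degreePart k 0 = 1 ∧
      (∀ (n : ℕ), ∀ x ∈ HGF.degreePart k n,
        Coalgebra.comul (R := ℚ) x ∈ ⨆ (i : ℕ) (j : ℕ) (_ : i + j = n),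
          LinearMap.range (TensorProduct.map (HGF.degreePart k i).subtype
            (HGF.degreePart k j).subtype)) := by
  refine ⟨HGF.hopfAlgebra k, rfl, HGF.gen_mul_gen, ?_, ?_, ?_, ?_, HGF.degreePart_gradedMonoid k,
    HGF.degreePart_isInternal k, HGF.degreePart_zero k, fun n x hx => HGF.lift_comulHom_mem hx⟩
  · intro P hP
    rw [HGF.gen_eq]
    exact (HGF.comul_of P.2).trans (HGF.coproductSum_eq_coproduct hP)
  · intro P hP hF X hX hleg
    exact SameLegPartition.sameTreeNumber hX.edges (isActive_of_isConnected hP hX.edges hX.proper)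
      hF hleg
  · intro P hP
    rw [HGF.gen_eq]
    exact HGF.lift_counitHom_of_isEmpty P.2 hP
  · intro P hP
    rw [HGF.gen_eq]
    exact HGF.lift_counitHom_of_not_isEmpty P.2 (not_isEmpty_iff.2 hP)
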